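/- **Setting.** Let $n\ge 2$ and let $H_n=\mathbb R^{2n}\times\mathbb R$, with points $(x,y,t)$, be the Heisenberg group with multiplication $(x,y,t)\circ(\tilde x,\tilde y,\tilde t)=\big(x+\tilde x,\,y+\tilde y,\,t+\tilde t+\sum_j(y_j\tilde x_j-x_j\tilde y_j)\big)$. Let $\Theta=dt+\sum_j(x_jdy_j-y_jdx_j)$, $\xi=\ker\Theta$ and $T=\partial_t$. The frame $\mathring e_j=\partial_{x_j}+y_j\partial_t$, $\mathring e_{n+j}=\partial_{y_j}-x_j\partial_t$ $(1\le j\le n)$ of $\xi$ is orthonormal for the Levi metric $\langle\cdot,\cdot\rangle=\sum_j(dx_j^2+dy_j^2)$ on $\xi$; let $J\mathring e_j=\mathring e_{n+j}$, $J\mathring e_{n+j}=-\mathring e_j$, and let $\nabla$ be the pseudohermitian connection, for which $\nabla\mathring e_j=\nabla\mathring e_{n+j}=0$. Let $\Sigma$ be an immersed hypersurface of $H_n$ (without boundary) of class $C^2$. A point $p\in\Sigma$ is singular if $T_p\Sigma=\xi_p$ and regular otherwise; the regular part of $\Sigma$ is assumed to be $C^\infty$. At regular points let $\xi'=(\xi\cap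 T\Sigma)\cap J(\xi\cap T\Sigma)$, let $e_n$ be a unit vector in $\xi\cap T\Sigma$ orthogonal to $\xi'$ (locally a smooth field, determined up to sign), and let $e_{2n}=Je_n$. The function $\alpha$ is defined by $\alpha e_{2n}+T\in T\Sigma$, and $l$ by $-\nabla_{e_n}e_{2n}\equiv l\,e_n \pmod{\xi'}$. Let $J'=J$ on $\xi'$ and $J'e_n=0$, and let $S(v)=-\nabla_ve_{2n}+\alpha J'v$ for $v\in\xi\cap T\Sigma$. A regular point is umbilic if $S(\xi')\subset\xi'$ and all eigenvalues of $S$ on $\xi'$ are equal; the common eigenvalue is denoted by $k$. Replacing $e_n$ by $-e_n$ changes the signs of $\alpha$, $k$ and $l$ simultaneously. $\Sigma$ is an umbilic hypersurface if all its regular points are umbilic. $\Sigma$ is congruent with part of a set $Q\subset H_n$ if some left translation of $H_n$ maps $\Sigma$ into $Q$. **Theorem 1.5.** Let $\Sigma$ be an umbilic hypersurface of $H_n$, $n\ge2$, with $\alpha=0$ at all regular points. Then: 1. $\Sigma$ has no singular points, and for any smooth choice of $e_n$ on a connected open subset of $\Sigma$ the function $k$ is constant there. (Thus $k$ is locally constant,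 and it is constant on $\Sigma$ if $\Sigma$ is connected and $e_n$ is chosen smoothly on $\Sigma$.) 2. If $\Sigma$ is connected and $k=k_0>0$ at some point for some choice of $e_n$ near that point, then $l=k$ and $|k|=k_0$ at every point of $\Sigma$ and for every local smooth choice of $e_n$, and $\Sigma$ is congruent with part of the vertical cylinder $S^{2n-1}(1/k_0)\times\mathbb R$, where $S^{2n-1}(c)=\{z\in\mathbb R^{2n}:|z|=c\}$. 3. If $\Sigma$ is connected and $k=l=0$ on $\Sigma$, then $\Sigma$ is congruent with part of $E\times\mathbb R$ for some hyperplane $E=\{z\in\mathbb R^{2n}:\langle A,z\rangle=0\}$, $A\ne0$. -/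

import Mathlib

open scoped Manifold ContDiff InnerProductSpace

noncomputable section

namespace Heisenberg

/-- `R^{2n}` with its Euclidean inner product; `z (inl j)` is `x_j` and `z (inr j)` is `y_j`. -/
abbrev R2n (n : ℕ) : Type := EuclideanSpace ℝ (Fin n ⊕ Fin n)

/-- The underlying manifold `R^{2n+1}` of the Heisenberg group, with points `(z, t)`. Its tangent
space at every point is identified with `R2n n × ℝ` through the coordinates `(x, y, t)`. -/
abbrev Heis (n : ℕ) : Type := R2n n × ℝ

/-- The group multiplication of the Heisenberg group. -/
def mul {n : ℕ} (p q : Heis n) : Heis n :=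
  (p.1 + q.1, p.2 + q.2 +
    ∑ j : Fin n, (p.1 (Sum.inr j) * q.1 (Sum.inl j) - p.1 (Sum.inl j) * q.1 (Sum.inr j)))

/-- The contact form `Θ = dt + ∑ (x_j dy_j - y_j dx_j)` at the point `p`. -/
def contactForm {n : ℕ} (p : Heis n) : Heis n →ₗ[ℝ] ℝ where
  toFun X := X.2 +
    ∑ j : Fin n, (p.1 (Sum.inl j) * X.1 (Sum.inr j) - p.1 (Sum.inr j) * X.1 (Sum.inl j))
  map_add' X Y := by
    simp only [Prod.fst_add, Prod.snd_add, PiLp.add_apply]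
    rw [add_add_add_comm, ← Finset.sum_add_distrib]
    congr 1
    exact Finset.sum_congr rfl fun j _ => by ring
  map_smul' c X := by
    simp only [Prod.smul_fst, Prod.smul_snd, PiLp.smul_apply, smul_eq_mul, RingHom.id_apply]
    rw [mul_add, Finset.mul_sum]
    congr 1
    exact Finset.sum_congr rfl fun j _ => by ring

/-- The contact plane `ξ_p = ker Θ_p`. -/
def contactPlane {n : ℕ} (p : Heis n) : Submodule ℝ (Heis n) :=
  LinearMap.ker (contactForm p)

/-- The vector `∑ a_j e_j + a_{n+j} e_{n+j}` of `ξ_p`, where `e_j = ∂/∂x_j + y_j ∂/∂t` and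
`e_{n+j} = ∂/∂y_j - x_j ∂/∂t` is the standard left invariant frame of `ξ`. This identifies `ξ_p`
with `R2n n`. Under this identification the Levi metric `∑ (dx_j² + dy_j²)` on `ξ_p` is the
Euclidean inner product, and a section of `ξ` becomes a function with values in `R2n n`. -/
def lift {n : ℕ} (p : Heis n) : R2n n →ₗ[ℝ] Heis n where
  toFun a := (a,
    ∑ j : Fin n, (p.1 (Sum.inr j) * a (Sum.inl j) - p.1 (Sum.inl j) * a (Sum.inr j)))
  map_add' a b := by
    refine Prod.ext rfl ?_
    simp only [Prod.mk_add_mk, PiLp.add_apply]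
    rw [← Finset.sum_add_distrib]
    exact Finset.sum_congr rfl fun j _ => by ring
  map_smul' c a := by
    refine Prod.ext rfl ?_
    simp only [Prod.smul_mk, PiLp.smul_apply, smul_eq_mul, RingHom.id_apply]
    rw [Finset.mul_sum]
    exact Finset.sum_congr rfl fun j _ => by ring

/-- The Reeb field `T = ∂/∂t`. -/
def reeb (n : ℕ) : Heis n := (0, 1)

/-- The CR structure in the standard frame: `J e_j = e_{n+j}` and `J e_{n+j} = - e_j`. -/
def J (n : ℕ) : R2n n →ₗ[ℝ] R2n n where
  toFun a := WithLp.toLp 2 (Sum.elim (fun j => -a (Sum.inr j)) (fun j => a (Sum.inl j)))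
  map_add' a b := by
    ext i
    rcases i with j | j
    · simp [add_comm]
    · simp
  map_smul' c a := by
    ext i
    rcases i with j | j <;> simp

section Hypersurface

variable {n : ℕ} {M : Type*} [TopologicalSpace M] [ChartedSpace (EuclideanSpace ℝ (Fin (2 * n))) M]

/-- The differential `T_pM → T_{f p} H_n` of a map `f` into the Heisenberg group. -/
def df (f : M → Heis n) (p : M) : EuclideanSpace ℝ (Fin (2 * n)) →L[ℝ] Heis n :=
  mfderiv (𝓡 (2 * n)) 𝓘(ℝ, Heis n) f p

/-- The tangent space `T_pΣ` of the immersed hypersurface, as a subspace of `T_{f p} H_n`. -/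
def tangent (f : M → Heis n) (p : M) : Submodule ℝ (Heis n) :=
  LinearMap.range (df f p).toLinearMap

/-- `p` is singular when `ξ = TΣ` at `p`; otherwise it is regular. -/
def IsRegularPoint (f : M → Heis n) (p : M) : Prop :=
  tangent f p ≠ contactPlane (f p)

/-- An immersed hypersurface of `H_n`: a `C^2` immersion of a `2n`-dimensional manifold, which is
`C^∞` on the regular part. -/
structure IsHypersurface (f : M → Heis n) : Prop where
  contMDiff_two : ContMDiff (𝓡 (2 * n)) 𝓘(ℝ, Heis n) 2 f
  immersion : ∀ p, Function.Injective (df f p)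
  smooth_of_regular : ∀ p, IsRegularPoint f p → ContMDiffAt (𝓡 (2 * n)) 𝓘(ℝ, Heis n) ∞ f p

/-- `ξ ∩ TΣ` at `p`, in the standard frame of `ξ`. -/
def horTangent (f : M → Heis n) (p : M) : Submodule ℝ (R2n n) :=
  (tangent f p).comap (lift (f p))

/-- `ξ' = (ξ ∩ TΣ) ∩ J (ξ ∩ TΣ)` at `p`, in the standard frame of `ξ`. -/
def xiPrime (f : M → Heis n) (p : M) : Submodule ℝ (R2n n) :=
  horTangent f p ⊓ (horTangent f p).map (J n)

/-- `v` is one of the two possible values of `e_n` at `p`: a unit vector of `ξ ∩ TΣ` which is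
perpendicular to `ξ'` for the Levi metric. -/
def IsCharDir (f : M → Heis n) (p : M) (v : R2n n) : Prop :=
  v ∈ horTangent f p ∧ v ∈ (xiPrime f p)ᗮ ∧ ‖v‖ = 1

/-- `e` is a smooth choice of `e_n` on the open subset `U` of the regular part. On `U` it is unique
up to sign on connected components; the horizontal normal is `e_{2n} = J e_n`. -/
structure IsCharField (f : M → Heis n) (U : Set M) (e : M → R2n n) : Prop where
  isOpen : IsOpen U
  regular : ∀ p ∈ U, IsRegularPoint f p
  smooth : ContMDiffOn (𝓡 (2 * n)) 𝓘(ℝ, R2n n) ∞ e U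
  charDir : ∀ p ∈ U, IsCharDir f p (e p)

/-- The function `α`, for the value `v` of `e_n` at the regular point `p`: the unique real number
such that `α e_{2n} + T` is tangent to `Σ`. -/
def alpha (f : M → Heis n) (p : M) (v : R2n n) : ℝ :=
  Classical.epsilon fun a : ℝ => lift (f p) (a • J n v) + reeb n ∈ tangent f p

/-- The covariant derivative, along a tangent vector `u` of `Σ`, of a section `s` of `ξ` along `Σ`,
for the pseudohermitian connection. This connection makes the standard frame of `ξ` parallel, so
it is the derivative of the components of `s`. -/
def nabla (s : M → R2n n) (p : M) (u : EuclideanSpace ℝ (Fin (2 * n))) : R2n n :=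
  (mfderiv (𝓡 (2 * n)) 𝓘(ℝ, R2n n) s p : EuclideanSpace ℝ (Fin (2 * n)) →L[ℝ] R2n n) u

/-- `J'` on `ξ ∩ TΣ = ξ' ⊕ ℝ e_n`: equal to `J` on `ξ'`, and `J' e_n = 0`; here `v = e_n`. -/
def JPrime (v w : R2n n) : R2n n := J n (w - ⟪v, w⟫_ℝ • v)

/-- The shape operator `S(w) = - ∇_w e_{2n} + α J' w`, where `w ∈ ξ ∩ TΣ` is the image under the
differential of `f` of the tangent vector `u` of `M`. -/
def shape (f : M → Heis n) (e : M → R2n n) (p : M) (u : EuclideanSpace ℝ (Fin (2 * n))) : R2n n :=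
  -nabla (fun q => J n (e q)) p u + alpha f p (e p) • JPrime (e p) (df f p u).1

/-- `κ` is the only eigenvalue of `S` on `ξ'` at `p` (`S` is diagonalizable on `ξ'`, so this says
that `S = κ` on `ξ'`). -/
def IsPrincipalValue (f : M → Heis n) (e : M → R2n n) (p : M) (κ : ℝ) : Prop :=
  ∀ u : EuclideanSpace ℝ (Fin (2 * n)), ∀ w ∈ xiPrime f p, df f p u = lift (f p) w →
    shape f e p u = κ • w

/-- The regular point `p` is umbilic: for a choice of `e_n` near `p`, the shape operator maps `ξ'`
to itself and all its eigenvalues on `ξ'` are equal. (Both conditions are unchanged when `e_n` is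
replaced by `-e_n`.) -/
def IsUmbilicPoint (f : M → Heis n) (p : M) : Prop :=
  ∃ (U : Set M) (e : M → R2n n), IsCharField f U e ∧ p ∈ U ∧
    (∀ u : EuclideanSpace ℝ (Fin (2 * n)), ∀ w ∈ xiPrime f p, df f p u = lift (f p) w →
      shape f e p u ∈ xiPrime f p) ∧
    ∃ κ : ℝ, IsPrincipalValue f e p κ

/-- The hypersurface is umbilic: all its regular points are umbilic. -/
def IsUmbilic (f : M → Heis n) : Prop :=
  ∀ p, IsRegularPoint f p → IsUmbilicPoint f p

/-- The common eigenvalue `k` of the shape operator on `ξ'` at an umbilic point. -/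
def k (f : M → Heis n) (e : M → R2n n) (p : M) : ℝ :=
  Classical.epsilon fun κ : ℝ => IsPrincipalValue f e p κ

/-- The function `l`: the unique real number such that `-∇_{e_n} e_{2n} = l e_n` modulo `ξ'`. -/
def l (f : M → Heis n) (e : M → R2n n) (p : M) : ℝ :=
  Classical.epsilon fun c : ℝ => ∃ u : EuclideanSpace ℝ (Fin (2 * n)),
    df f p u = lift (f p) (e p) ∧ -nabla (fun q => J n (e q)) p u - c • e p ∈ xiPrime f p

/-- The hypersurface is congruent with part of `S`: a Heisenberg translation maps it into `S`. -/
def IsCongruentToPart (f : M → Heis n) (S : Set (Heis n)) : Prop :=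
  ∃ g : Heis n, ∀ p, mul g (f p) ∈ S

end Hypersurface

/-- The vertical cylinder `S^{2n-1}(c) × ℝ` over the sphere of radius `c` about the origin. -/
def sphereCylinder (n : ℕ) (c : ℝ) : Set (Heis n) := {p | ‖p.1‖ = c}

/-- The vertical hyperplane `E × ℝ`, where `E ⊂ R^{2n}` is the hyperplane with normal `A`. -/
def hyperplaneCylinder {n : ℕ} (A : R2n n) : Set (Heis n) := {p | ⟪A, p.1⟫_ℝ = 0}

end Heisenberg

end

noncomputable section

namespace Heisenberg

/-! Vanishing `α` makes `T` tangent, so at a regular point the tangent space is a vertical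
hyperplane with horizontal normal `e_{2n}` (`mem_tangent_iff`). Locally the hypersurface then lies
over a Euclidean hypersurface: the projection `π = (f ·).1` has rank `2n - 1` and unit normal `ν = J
e_n`. The standard frame is parallel, so `-∇ e_{2n}` is the Euclidean shape operator, with value `k`
on `ξ'` and `l` on `e_n`.

Writing `l = κ + m` with `κ = k`, one has `dν = -κ dπ - m ⟪Iν, dπ⟫ Iν`. Symmetry of second
derivatives gives a Codazzi equation; tested on `w` and `I w` in `ξ'`, which is nonzero because `n ≥
2`, it yields `m κ = 0` and `dκ = 0` (`mul_eq_zero_and_fderiv_eq_zero`). So `k` is locally constant,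
and `l = k` wherever `k ≠ 0`. In that case `ν + k π` is locally constant, which gives a sphere; if
`k = l = 0`, then `ν` is locally constant, which gives a hyperplane. Since `e_n` is only determined
up to sign, globalization uses sign-invariant, locally constant quantities.

Near a singular point `T` stays transverse, while it is tangent at every regular point. A whole
neighbourhood would thus be singular, contradicting the nonintegrability of `ξ`. -/

theorem eq_zero_of_inner_eq_zero {F : Type*} [NormedAddCommGroup F] [InnerProductSpace ℝ F]
    {a b z : F}
    (h0 : ⟪a, z⟫_ℝ = 0) (h1 : ∀ w, ⟪a, w⟫_ℝ = 0 → ⟪b, w⟫_ℝ = 0 → ⟪z, w⟫_ℝ = 0)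
    (h2 : ⟪b, z⟫_ℝ = 0) : z = 0 :=
  inner_self_eq_zero.1 (h1 z h0 h2)

/-! ### Symmetry of second derivatives -/

section SecondDerivative

variable {E F : Type*} [NormedAddCommGroup E] [NormedSpace ℝ E]
  [NormedAddCommGroup F] [NormedSpace ℝ F] {g : E → F} {x : E}

theorem hasFDerivAt_fderiv (h : ContDiffAt ℝ 2 g x) :
    HasFDerivAt (fderiv ℝ g) (fderiv ℝ (fderiv ℝ g) x) x :=
  ((h.fderiv_right (m := 1) (by norm_num)).differentiableAt (by norm_num)).hasFDerivAt

theorem hasFDerivAt_fderiv_apply (h : ContDiffAt ℝ 2 g x) (u : E) :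
    HasFDerivAt (fun y => fderiv ℝ g y u) ((fderiv ℝ (fderiv ℝ g) x).flip u) x := by
  have := (hasFDerivAt_fderiv h).clm_apply (hasFDerivAt_const u x)
  convert this using 1
  ext v; simp

theorem fderiv_fderiv_comm (h : ContDiffAt ℝ 2 g x) (u v : E) :
    fderiv ℝ (fderiv ℝ g) x u v = fderiv ℝ (fderiv ℝ g) x v u :=
  (h.isSymmSndFDerivAt (by simp)).eq u v

end SecondDerivative

/-! ### Euclidean hypersurfaces umbilic on the complex part of the tangent space -/

section Local

variable {E F : Type*} [NormedAddCommGroup E] [NormedSpace ℝ E]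
  [NormedAddCommGroup F] [InnerProductSpace ℝ F]

/-- A map `π` with unit normal field `ν` on the open set `V`, whose second fundamental form is `κ`
times the metric on the orthogonal complement of `ν` and `I ν`. -/
structure IsComplexUmbilic (I : F →L[ℝ] F) (V : Set E) (π ν : E → F) (κ : E → ℝ) : Prop where
  isOpen : IsOpen V
  contDiffAt : ∀ x ∈ V, ContDiffAt ℝ 2 π x
  contDiffAt_normal : ∀ x ∈ V, ContDiffAt ℝ 2 ν x
  I_I : ∀ w, I (I w) = -w
  inner_I : ∀ v w, ⟪I v, w⟫_ℝ = -⟪v, I w⟫_ℝ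
  inner_normal_self : ∀ x ∈ V, ⟪ν x, ν x⟫_ℝ = 1
  inner_normal : ∀ x ∈ V, ∀ u, ⟪ν x, fderiv ℝ π x u⟫_ℝ = 0
  exists_fderiv_eq : ∀ x ∈ V, ∀ w, ⟪ν x, w⟫_ℝ = 0 → ∃ u, fderiv ℝ π x u = w
  umbilic : ∀ x ∈ V, ∀ w, ⟪ν x, w⟫_ℝ = 0 → ⟪I (ν x), w⟫_ℝ = 0 →
    ∃ u, fderiv ℝ π x u = w ∧ fderiv ℝ ν x u = -κ x • w
  exists_ne_zero : ∀ x ∈ V, ∃ w, w ≠ 0 ∧ ⟪ν x, w⟫_ℝ = 0 ∧ ⟪I (ν x), w⟫_ℝ = 0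

namespace IsComplexUmbilic

variable {I : F →L[ℝ] F} {V : Set E} {π ν : E → F} {κ : E → ℝ}

theorem inner_I_self (h : IsComplexUmbilic I V π ν κ) (w : F) : ⟪I w, w⟫_ℝ = 0 := by
  have := h.inner_I w w
  rw [real_inner_comm] at this ⊢
  linarith

theorem inner_I_I (h : IsComplexUmbilic I V π ν κ) (v w : F) : ⟪I v, I w⟫_ℝ = ⟪v, w⟫_ℝ := by
  rw [h.inner_I, h.I_I, inner_neg_right, neg_neg]

theorem hasFDerivAt_normal (h : IsComplexUmbilic I V π ν κ) {x : E} (hx : x ∈ V) :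
    HasFDerivAt ν (fderiv ℝ ν x) x :=
  ((h.contDiffAt_normal x hx).differentiableAt (by norm_num)).hasFDerivAt

theorem inner_normal_fderiv_normal (h : IsComplexUmbilic I V π ν κ) {x : E} (hx : x ∈ V) (u : E) :
    ⟪ν x, fderiv ℝ ν x u⟫_ℝ = 0 := by
  have h1 := (h.hasFDerivAt_normal hx).inner ℝ (h.hasFDerivAt_normal hx)
  have h2 : HasFDerivAt (fun y => ⟪ν y, ν y⟫_ℝ) (0 : E →L[ℝ] ℝ) x :=
    (hasFDerivAt_const (1 : ℝ) x).congr_of_eventuallyEq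
      (Filter.eventually_of_mem (h.isOpen.mem_nhds hx) fun y hy => h.inner_normal_self y hy)
  have h3 := DFunLike.congr_fun (h1.unique h2) u
  simpa [real_inner_comm] using h3

/-- The second fundamental form is symmetric. -/
theorem inner_fderiv_normal_comm (h : IsComplexUmbilic I V π ν κ) {x : E} (hx : x ∈ V) (u v : E) :
    ⟪fderiv ℝ ν x u, fderiv ℝ π x v⟫_ℝ = ⟪fderiv ℝ ν x v, fderiv ℝ π x u⟫_ℝ := by
  have key : ∀ u v, ⟪fderiv ℝ ν x u, fderiv ℝ π x v⟫_ℝ =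
      - ⟪ν x, fderiv ℝ (fderiv ℝ π) x u v⟫_ℝ := by
    intro u v
    have h1 := (h.hasFDerivAt_normal hx).inner ℝ (hasFDerivAt_fderiv_apply (h.contDiffAt x hx) v)
    have h2 : HasFDerivAt (fun y => ⟪ν y, fderiv ℝ π y v⟫_ℝ) (0 : E →L[ℝ] ℝ) x :=
      (hasFDerivAt_const (0 : ℝ) x).congr_of_eventuallyEq
        (Filter.eventually_of_mem (h.isOpen.mem_nhds hx) fun y hy => h.inner_normal y hy v)
    have h3 := DFunLike.congr_fun (h1.unique h2) u
    simp at h3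
    linarith
  rw [key, key, fderiv_fderiv_comm (h.contDiffAt x hx)]

/-- Here `π` need not be an immersion: in the application it collapses the vertical direction. Since
`dν u` is orthogonal to `ν`, it equals `dπ v` for some `v`, and symmetry turns its squared norm into
`⟪dν v, dπ u⟫ = 0`. Hence `dν` factors through `dπ`. -/
theorem fderiv_normal_eq_zero (h : IsComplexUmbilic I V π ν κ) {x : E} (hx : x ∈ V) {u : E}
    (hu : fderiv ℝ π x u = 0) : fderiv ℝ ν x u = 0 := by
  obtain ⟨v, hv⟩ := h.exists_fderiv_eq x hx _ (h.inner_normal_fderiv_normal hx u)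
  have := h.inner_fderiv_normal_comm hx u v
  rw [hv, hu, inner_zero_right] at this
  exact inner_self_eq_zero.1 this

theorem fderiv_normal_congr (h : IsComplexUmbilic I V π ν κ) {x : E} (hx : x ∈ V) {u v : E}
    (huv : fderiv ℝ π x u = fderiv ℝ π x v) : fderiv ℝ ν x u = fderiv ℝ ν x v := by
  rw [← sub_eq_zero, ← map_sub]
  exact h.fderiv_normal_eq_zero hx (by rw [map_sub, huv, sub_self])

/-- The derivative of the normal in terms of the two principal values `κ` and `κ + m`. -/
theorem exists_fderiv_normal_eq (h : IsComplexUmbilic I V π ν κ) : ∃ m : E → ℝ, ∀ x ∈ V, ∀ u,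
    fderiv ℝ ν x u =
      -κ x • fderiv ℝ π x u - (m x * ⟪I (ν x), fderiv ℝ π x u⟫_ℝ) • I (ν x) := by
  have : ∀ x : E, ∃ m : ℝ, x ∈ V → ∀ u, fderiv ℝ ν x u =
      -κ x • fderiv ℝ π x u - (m * ⟪I (ν x), fderiv ℝ π x u⟫_ℝ) • I (ν x) := by
    intro x
    by_cases hx : x ∈ V
    swap
    · exact ⟨0, fun h => absurd h hx⟩
    have haν : ⟪ν x, I (ν x)⟫_ℝ = 0 := by rw [real_inner_comm, h.inner_I_self]
    have haa : ⟪I (ν x), I (ν x)⟫_ℝ = 1 := by rw [h.inner_I_I, h.inner_normal_self x hx]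
    obtain ⟨v, hv⟩ := h.exists_fderiv_eq x hx (I (ν x)) haν
    set c := ⟪I (ν x), fderiv ℝ ν x v⟫_ℝ with hc
    have hDv : fderiv ℝ ν x v = c • I (ν x) := by
      rw [← sub_eq_zero]
      refine eq_zero_of_inner_eq_zero (a := ν x) (b := I (ν x)) ?_ ?_ ?_
      · rw [inner_sub_right, inner_smul_right, haν, h.inner_normal_fderiv_normal hx]; simp
      · intro w hw hw'
        obtain ⟨y, hy, hy'⟩ := h.umbilic x hx w hw hw'
        have := h.inner_fderiv_normal_comm hx v y
        rw [hy, hy', hv, inner_smul_left, real_inner_comm (I (ν x)) w, hw'] at this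
        rw [inner_sub_left, inner_smul_left, hw', this]; simp
      · rw [inner_sub_right, inner_smul_right, haa, hc]; simp
    -- In the direction `I ν` the formula reads `c = -κ - m`.
    refine ⟨-(c + κ x), fun _ u => ?_⟩
    set θ := ⟪I (ν x), fderiv ℝ π x u⟫_ℝ with hθ
    obtain ⟨y, hy, hy'⟩ := h.umbilic x hx (fderiv ℝ π x u - θ • I (ν x))
      (by rw [inner_sub_right, inner_smul_right, haν, h.inner_normal x hx]; simp)
      (by rw [inner_sub_right, inner_smul_right, haa, hθ]; simp)
    have : fderiv ℝ π x u = fderiv ℝ π x (y + θ • v) := by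
      rw [map_add, map_smul, hy, hv]; abel
    rw [h.fderiv_normal_congr hx this, map_add, map_smul, hDv, hy']
    module
  choose m hm using this
  exact ⟨m, fun x hx => hm x hx⟩

/-- The functions `κ` and `m` are only given pointwise, so their regularity is recovered by writing
them near `x` as quotients of inner products of derivatives of `π` and `ν`. -/
theorem differentiableAt_principalValue (h : IsComplexUmbilic I V π ν κ) {m : E → ℝ}
    (hm : ∀ x ∈ V, ∀ u, fderiv ℝ ν x u =
      -κ x • fderiv ℝ π x u - (m x * ⟪I (ν x), fderiv ℝ π x u⟫_ℝ) • I (ν x))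
    {x : E} (hx : x ∈ V) : DifferentiableAt ℝ κ x ∧ DifferentiableAt ℝ m x := by
  have hν := (h.hasFDerivAt_normal hx).differentiableAt
  have hπ := fun u => (hasFDerivAt_fderiv_apply (h.contDiffAt x hx) u).differentiableAt
  have hν' := fun u => (hasFDerivAt_fderiv_apply (h.contDiffAt_normal x hx) u).differentiableAt
  have hIν : DifferentiableAt ℝ (fun y => I (ν y)) x := by fun_prop
  have haν : ∀ y, ⟪ν y, I (ν y)⟫_ℝ = 0 := fun y => by rw [real_inner_comm, h.inner_I_self]
  have haa : ∀ y ∈ V, ⟪I (ν y), I (ν y)⟫_ℝ = 1 := fun y hy => by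
    rw [h.inner_I_I, h.inner_normal_self y hy]
  have hκ : DifferentiableAt ℝ κ x := by
    obtain ⟨w, hw0, hw1, hw2⟩ := h.exists_ne_zero x hx
    obtain ⟨u, hu⟩ := h.exists_fderiv_eq x hx w hw1
    -- Removing the `I ν` component kills the `m` term, so `⟪dν u, W⟫ = -κ ⟪W, W⟫` near `x`, with `W
    -- x = w ≠ 0`.
    let W : E → F := fun y => fderiv ℝ π y u - ⟪I (ν y), fderiv ℝ π y u⟫_ℝ • I (ν y)
    have hWd : DifferentiableAt ℝ W x :=
      (hπ u).sub (((hIν.inner ℝ (hπ u))).smul hIν)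
    have hWx : ⟪W x, W x⟫_ℝ ≠ 0 := by
      simp only [W, hu, hw2, zero_smul, sub_zero]
      exact inner_self_ne_zero.2 hw0
    have hWne : ∀ᶠ y in nhds x, ⟪W y, W y⟫_ℝ ≠ 0 :=
      (hWd.continuousAt.inner hWd.continuousAt).eventually_ne hWx
    have hd : DifferentiableAt ℝ (fun y => -⟪fderiv ℝ ν y u, W y⟫_ℝ / ⟪W y, W y⟫_ℝ) x := by
      have h1 := ((hν' u).inner ℝ hWd).fun_neg
      have h2 := hWd.inner ℝ hWd
      simpa only [div_eq_mul_inv] using h1.fun_mul (h2.fun_inv hWx)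
    refine hd.congr_of_eventuallyEq ?_
    filter_upwards [hWne, h.isOpen.mem_nhds hx] with y hy hyV
    rw [eq_div_iff hy]
    have hIW : ⟪I (ν y), W y⟫_ℝ = 0 := by
      simp only [W]; rw [inner_sub_right, inner_smul_right, haa y hyV]; simp
    have : fderiv ℝ π y u = W y + ⟪I (ν y), fderiv ℝ π y u⟫_ℝ • I (ν y) := by
      simp only [W]; abel
    have h2 : ⟪fderiv ℝ π y u, W y⟫_ℝ = ⟪W y, W y⟫_ℝ := by
      nth_rw 1 [this]
      rw [inner_add_left, inner_smul_left, hIW]; simp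
    rw [hm y hyV, inner_sub_left (_ • _), inner_smul_left, inner_smul_left, hIW, h2]
    simp
  refine ⟨hκ, ?_⟩
  obtain ⟨u, hu⟩ := h.exists_fderiv_eq x hx (I (ν x)) (haν x)
  have hθx : ⟪I (ν x), fderiv ℝ π x u⟫_ℝ ≠ 0 := by rw [hu, haa x hx]; norm_num
  have hd : DifferentiableAt ℝ
      (fun y => -⟪I (ν y), fderiv ℝ ν y u⟫_ℝ / ⟪I (ν y), fderiv ℝ π y u⟫_ℝ - κ y) x := by
    have h1 := (hIν.inner ℝ (hν' u)).fun_neg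
    have h2 := hIν.inner ℝ (hπ u)
    simpa only [div_eq_mul_inv] using (h1.fun_mul (h2.fun_inv hθx)).fun_sub hκ
  refine hd.congr_of_eventuallyEq ?_
  filter_upwards [(hIν.continuousAt.inner (hπ u).continuousAt).eventually_ne hθx,
    h.isOpen.mem_nhds hx] with y hy hyV
  rw [eq_sub_iff_add_eq, eq_div_iff hy, hm y hyV, inner_sub_right, inner_smul_right,
    inner_smul_right, haa y hyV]
  ring

/-- The Codazzi equation. -/
theorem codazzi (h : IsComplexUmbilic I V π ν κ) {m : E → ℝ}
    (hm : ∀ x ∈ V, ∀ u, fderiv ℝ ν x u =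
      -κ x • fderiv ℝ π x u - (m x * ⟪I (ν x), fderiv ℝ π x u⟫_ℝ) • I (ν x))
    {x : E} (hx : x ∈ V) (u v : E) :
    fderiv ℝ κ x u • fderiv ℝ π x v - fderiv ℝ κ x v • fderiv ℝ π x u
      + (fderiv ℝ m x u * ⟪I (ν x), fderiv ℝ π x v⟫_ℝ
          - fderiv ℝ m x v * ⟪I (ν x), fderiv ℝ π x u⟫_ℝ
          - 2 * (m x * κ x) * ⟪I (fderiv ℝ π x u), fderiv ℝ π x v⟫_ℝ) • I (ν x)
      + (m x * κ x) • (⟪I (ν x), fderiv ℝ π x u⟫_ℝ • I (fderiv ℝ π x v)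
          - ⟪I (ν x), fderiv ℝ π x v⟫_ℝ • I (fderiv ℝ π x u)) = 0 := by
  obtain ⟨hκ, hm'⟩ := h.differentiableAt_principalValue hm hx
  have hIν : HasFDerivAt (fun y => I (ν y)) (I.comp (fderiv ℝ ν x)) x :=
    I.hasFDerivAt.comp x (h.hasFDerivAt_normal hx)
  have hDI : ∀ u, I (fderiv ℝ ν x u) =
      -κ x • I (fderiv ℝ π x u) + (m x * ⟪I (ν x), fderiv ℝ π x u⟫_ℝ) • ν x := by
    intro u
    rw [hm x hx, map_sub, map_smul, map_smul, h.I_I]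
    module
  -- Differentiate `hm`. On antisymmetrizing in `u` and `v`, the second derivatives of `π` and the
  -- multiples of `ν` coming from `hDI` cancel.
  have key : ∀ u v, fderiv ℝ (fderiv ℝ ν) x u v =
      -fderiv ℝ κ x u • fderiv ℝ π x v - κ x • fderiv ℝ (fderiv ℝ π) x u v
      - (fderiv ℝ m x u * ⟪I (ν x), fderiv ℝ π x v⟫_ℝ
        + m x * (⟪I (ν x), fderiv ℝ (fderiv ℝ π) x u v⟫_ℝ
          + ⟪I (fderiv ℝ ν x u), fderiv ℝ π x v⟫_ℝ)) • I (ν x)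
      - (m x * ⟪I (ν x), fderiv ℝ π x v⟫_ℝ) • I (fderiv ℝ ν x u) := by
    intro u v
    have hπ := hasFDerivAt_fderiv_apply (h.contDiffAt x hx) v
    have h1 := (hκ.hasFDerivAt.neg.smul hπ).sub
      ((hm'.hasFDerivAt.mul (hIν.inner ℝ hπ)).smul hIν)
    have h2 := hasFDerivAt_fderiv_apply (h.contDiffAt_normal x hx) v
    have h3 := h1.congr_of_eventuallyEq (f₁ := fun y => fderiv ℝ ν y v)
      (Filter.eventually_of_mem (h.isOpen.mem_nhds hx) fun y hy => hm y hy v)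
    have h4 := DFunLike.congr_fun (h2.unique h3) u
    simp at h4
    rw [h4]
    module
  have hsymm := fderiv_fderiv_comm (h.contDiffAt_normal x hx) u v
  -- Skewness of `I` makes these two terms add up, whence the factor `2`.
  have hJ : ⟪I (fderiv ℝ π x v), fderiv ℝ π x u⟫_ℝ
      = -⟪I (fderiv ℝ π x u), fderiv ℝ π x v⟫_ℝ := by
    rw [h.inner_I, real_inner_comm]
  rw [key, key, fderiv_fderiv_comm (h.contDiffAt x hx) v u, hDI, hDI, inner_add_left,
    inner_add_left, inner_smul_left, inner_smul_left, inner_smul_left, inner_smul_left, hJ,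
    h.inner_normal x hx, h.inner_normal x hx, ← sub_eq_zero] at hsymm
  rw [← neg_eq_zero, ← hsymm]
  simp only [map_neg, conj_trivial]
  module

/-- Take `w ≠ 0` orthogonal to `ν` and `I ν`; then so is `I w`. In the Codazzi equation for `w` and
`I w`, the `I ν` component is `-2 m κ |w|²` and the `I w` component is `dκ(u) |w|²`, where `dπ u =
w`. -/
theorem mul_eq_zero_and_fderiv_eq_zero (h : IsComplexUmbilic I V π ν κ) {m : E → ℝ}
    (hm : ∀ x ∈ V, ∀ u, fderiv ℝ ν x u =
      -κ x • fderiv ℝ π x u - (m x * ⟪I (ν x), fderiv ℝ π x u⟫_ℝ) • I (ν x))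
    {x : E} (hx : x ∈ V) : m x * κ x = 0 ∧ fderiv ℝ κ x = 0 := by
  obtain ⟨w, hw0, hw1, hw2⟩ := h.exists_ne_zero x hx
  have hww : ⟪w, w⟫_ℝ ≠ 0 := inner_self_ne_zero.2 hw0
  have haw : ⟪I (ν x), I w⟫_ℝ = 0 := by rw [h.inner_I_I, hw1]
  have hνw : ⟪ν x, I w⟫_ℝ = 0 := by
    have := h.inner_I (ν x) w
    linarith
  have haa : ⟪I (ν x), I (ν x)⟫_ℝ = 1 := by rw [h.inner_I_I, h.inner_normal_self x hx]
  obtain ⟨u, hu⟩ := h.exists_fderiv_eq x hx w hw1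
  obtain ⟨v, hv⟩ := h.exists_fderiv_eq x hx (I w) hνw
  have hc := h.codazzi hm hx u v
  rw [hu, hv, hw2, haw, h.inner_I_I] at hc
  have h1 := congrArg (fun z => ⟪I (ν x), z⟫_ℝ) hc
  have h2 := congrArg (fun z => ⟪I w, z⟫_ℝ) hc
  have hIwa : ⟪I w, I (ν x)⟫_ℝ = 0 := by rw [real_inner_comm, haw]
  simp only [inner_add_right, inner_sub_right, inner_smul_right, hw2, haw, haa, hIwa, h.inner_I_I,
    h.inner_I_self, inner_zero_right] at h1 h2
  have hmk : m x * κ x = 0 := by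
    have : (m x * κ x) * ⟪w, w⟫_ℝ = 0 := by linarith
    exact (mul_eq_zero.1 this).resolve_right hww
  refine ⟨hmk, ?_⟩
  have hκu : fderiv ℝ κ x u = 0 := by
    have : fderiv ℝ κ x u * ⟪w, w⟫_ℝ = 0 := by linarith
    exact (mul_eq_zero.1 this).resolve_right hww
  ext y
  -- With `m κ` and `dκ(u)` already zero, pairing an arbitrary direction `y` with `u` leaves only
  -- `dκ(y) |w|²` along `w`.
  have hc := congrArg (fun z => ⟪w, z⟫_ℝ) (h.codazzi hm hx y u)
  simp only [hu, hmk, hκu, inner_add_right, inner_sub_right, inner_smul_right, inner_zero_right,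
    real_inner_comm (I (ν x)) w, hw2] at hc
  have : fderiv ℝ κ x y * ⟪w, w⟫_ℝ = 0 := by linarith
  simpa [hw0] using this

end IsComplexUmbilic

end Local

/-! ### Linear algebra of the tangent space at a regular point -/

section LinearAlgebra

variable {n : ℕ}

theorem J_J (w : R2n n) : J n (J n w) = -w := by
  ext i
  rcases i with j | j <;> simp [J]

theorem inner_J (v w : R2n n) : ⟪J n v, w⟫_ℝ = -⟪v, J n w⟫_ℝ := by
  simp [J, PiLp.inner_apply, Fintype.sum_sum_type]

theorem inner_J_J (v w : R2n n) : ⟪J n v, J n w⟫_ℝ = ⟪v, w⟫_ℝ := by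
  rw [inner_J, J_J, inner_neg_right, neg_neg]

theorem inner_J_self (w : R2n n) : ⟪J n w, w⟫_ℝ = 0 := by
  have := inner_J w w
  rw [real_inner_comm] at this ⊢
  linarith

@[simp] theorem lift_fst (p : Heis n) (w : R2n n) : (lift p w).1 = w := rfl

theorem contactForm_apply (p X : Heis n) : contactForm p X = X.2 - (lift p X.1).2 := by
  simp only [contactForm, lift, LinearMap.coe_mk, AddHom.coe_mk, sub_eq_add_neg,
    ← Finset.sum_neg_distrib]
  congr 1
  exact Finset.sum_congr rfl fun j _ => by ring

theorem lift_add_reeb (p X : Heis n) : lift p X.1 + contactForm p X • reeb n = X := by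
  refine Prod.ext (by simp [reeb]) ?_
  rw [contactForm_apply]
  simp [reeb]

theorem contactForm_lift (p : Heis n) (w : R2n n) : contactForm p (lift p w) = 0 := by
  rw [contactForm_apply]; simp

theorem contactForm_reeb (p : Heis n) : contactForm p (reeb n) = 1 := by
  simp [contactForm_apply, reeb]

variable {M : Type*} [TopologicalSpace M] [ChartedSpace (EuclideanSpace ℝ (Fin (2 * n))) M]
  {f : M → Heis n} {p : M}

/-- By dimension the tangent space is the kernel of a nonzero covector, which splits into a
horizontal part `b` and a multiple of `Θ`. If `b` vanished, the kernel would be `ξ` and the point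
singular. -/
theorem exists_conormal (hinj : Function.Injective (df f p)) (hreg : IsRegularPoint f p) :
    ∃ (b : R2n n) (c : ℝ), b ≠ 0 ∧
      ∀ X, X ∈ tangent f p ↔ ⟪b, X.1⟫_ℝ + c * contactForm (f p) X = 0 := by
  have hfin : Module.finrank ℝ (tangent f p) = 2 * n := by
    rw [tangent, LinearMap.finrank_range_of_inj hinj]; simp
  have hfinH : Module.finrank ℝ (Heis n) = 2 * n + 1 := by
    simp [Module.finrank_prod]; ring
  have hlt : tangent f p < ⊤ := by
    refine lt_top_iff_ne_top.2 fun h => ?_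
    rw [h, finrank_top, hfinH] at hfin
    omega
  obtain ⟨φ, hφ0, hφ⟩ := Submodule.exists_dual_map_eq_bot_of_lt_top hlt inferInstance
  have hker : tangent f p = LinearMap.ker φ := by
    refine Submodule.eq_of_le_of_finrank_eq (fun X hX => ?_) ?_
    · have : φ X ∈ (tangent f p).map φ := Submodule.mem_map_of_mem hX
      rw [hφ] at this
      exact this
    · have := Module.Dual.finrank_ker_add_one_of_ne_zero hφ0
      omega
  let ψ : R2n n →L[ℝ] ℝ := LinearMap.toContinuousLinearMap (φ ∘ₗ lift (f p))
  let b := (InnerProductSpace.toDual ℝ (R2n n)).symm ψ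
  have hb : ∀ X, φ X = ⟪b, X.1⟫_ℝ + φ (reeb n) * contactForm (f p) X := by
    intro X
    have : ⟪b, X.1⟫_ℝ = φ (lift (f p) X.1) := InnerProductSpace.toDual_symm_apply
    nth_rw 1 [← lift_add_reeb (f p) X]
    rw [map_add, map_smul, this, smul_eq_mul, mul_comm]
  refine ⟨b, φ (reeb n), fun h0 => hreg ?_, fun X => by rw [hker, LinearMap.mem_ker, hb]⟩
  have hc : φ (reeb n) ≠ 0 := by
    intro h
    refine hφ0 (LinearMap.ext fun X => ?_)
    rw [hb, h0, h]; simp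
  ext X
  rw [hker, contactPlane, LinearMap.mem_ker, LinearMap.mem_ker, hb, h0]
  simp [hc]

/-- At a regular point with `α = 0` the tangent space is the vertical hyperplane with horizontal
normal `e_{2n} = J e_n`. -/
theorem mem_tangent_iff (hinj : Function.Injective (df f p)) (hreg : IsRegularPoint f p)
    {v : R2n n} (hv : IsCharDir f p v) (hα : alpha f p v = 0) (X : Heis n) :
    X ∈ tangent f p ↔ ⟪J n v, X.1⟫_ℝ = 0 := by
  obtain ⟨b, c, hb0, hb⟩ := exists_conormal hinj hreg
  have hor : ∀ w, w ∈ horTangent f p ↔ ⟪b, w⟫_ℝ = 0 := fun w => by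
    rw [horTangent, Submodule.mem_comap, hb, contactForm_lift]; simp
  have hxi : ∀ w, ⟪b, w⟫_ℝ = 0 → ⟪J n b, w⟫_ℝ = 0 → w ∈ xiPrime f p := by
    intro w h1 h2
    refine ⟨(hor w).2 h1, -J n w, (hor _).2 ?_, by rw [map_neg, J_J, neg_neg]⟩
    rw [inner_neg_right, ← inner_J, h2]
  obtain ⟨hv1, hv2, hv3⟩ := hv
  have hbb : ⟪b, b⟫_ℝ ≠ 0 := inner_self_ne_zero.2 hb0
  have hbv : ⟪b, v⟫_ℝ = 0 := (hor v).1 hv1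
  have hbJ : ⟪b, J n b⟫_ℝ = 0 := by rw [real_inner_comm, inner_J_self]
  set s := ⟪J n b, v⟫_ℝ / ⟪b, b⟫_ℝ with hs
  have hw1 : ⟪b, v - s • J n b⟫_ℝ = 0 := by
    rw [inner_sub_right, inner_smul_right, hbJ, hbv]; simp
  have hw2 : ⟪J n b, v - s • J n b⟫_ℝ = 0 := by
    rw [inner_sub_right, inner_smul_right, inner_J_J, hs]; field_simp; simp
  -- The part of `v` orthogonal to `J b` lies in `ξ'`, to which `v` is orthogonal, so it vanishes.
  have hvs : v = s • J n b := by
    have h1 := hv2 _ (hxi _ hw1 hw2)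
    have h2 : ⟪v - s • J n b, v - s • J n b⟫_ℝ = 0 := by
      rw [inner_sub_right, h1, inner_smul_right, real_inner_comm (J n b), hw2]; simp
    rw [← sub_eq_zero]
    exact inner_self_eq_zero.1 h2
  have hs0 : s ≠ 0 := by
    rintro h
    rw [hvs, h, zero_smul, norm_zero] at hv3
    exact zero_ne_one hv3
  have hJv : J n v = -s • b := by rw [hvs, map_smul, J_J]; module
  -- `alpha` is an epsilon choice, so its defining property needs existence. As `J v = -s b`, the
  -- condition on `a` is `-a s ⟪b, b⟫ + c = 0`.
  have hex : ∃ a : ℝ, lift (f p) (a • J n v) + reeb n ∈ tangent f p := by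
    refine ⟨c / (s * ⟪b, b⟫_ℝ), (hb _).2 ?_⟩
    rw [map_add, contactForm_lift, contactForm_reeb, Prod.fst_add, lift_fst, hJv]
    simp only [reeb, add_zero, inner_smul_right]
    field_simp
    ring
  have hT := Classical.epsilon_spec hex
  change lift (f p) (alpha f p v • J n v) + reeb n ∈ tangent f p at hT
  rw [hα, zero_smul, map_zero, zero_add, hb, contactForm_reeb] at hT
  have hc : c = 0 := by simpa [reeb] using hT
  rw [hb, hc, hJv, inner_smul_left]
  simp [hs0]

theorem mem_horTangent_iff {v : R2n n} (h : ∀ X, X ∈ tangent f p ↔ ⟪J n v, X.1⟫_ℝ = 0)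
    (w : R2n n) : w ∈ horTangent f p ↔ ⟪J n v, w⟫_ℝ = 0 := by
  rw [horTangent, Submodule.mem_comap, h, lift_fst]

theorem mem_xiPrime_iff {v : R2n n} (h : ∀ X, X ∈ tangent f p ↔ ⟪J n v, X.1⟫_ℝ = 0)
    (w : R2n n) : w ∈ xiPrime f p ↔ ⟪J n v, w⟫_ℝ = 0 ∧ ⟪v, w⟫_ℝ = 0 := by
  rw [xiPrime, Submodule.mem_inf, mem_horTangent_iff h, Submodule.mem_map]
  refine and_congr_right fun _ => ⟨?_, fun hw => ⟨-J n w, ?_, by rw [map_neg, J_J, neg_neg]⟩⟩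
  · rintro ⟨y, hy, rfl⟩
    rw [mem_horTangent_iff h, inner_J] at hy
    linarith
  · rw [mem_horTangent_iff h, inner_neg_right, inner_J_J, hw, neg_zero]

/-- Two linear equations in dimension `2n ≥ 4` have a nonzero solution; only here is `n ≥ 2` needed
rather than `n ≥ 1`. -/
theorem exists_ne_zero_of_orthogonal (hn : 2 ≤ n) (a b : R2n n) :
    ∃ w : R2n n, w ≠ 0 ∧ ⟪a, w⟫_ℝ = 0 ∧ ⟪b, w⟫_ℝ = 0 := by
  let L : R2n n →ₗ[ℝ] ℝ × ℝ := (innerₗ (R2n n) a).prod (innerₗ (R2n n) b)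
  have h : LinearMap.ker L ≠ ⊥ := by
    apply LinearMap.ker_ne_bot_of_finrank_lt
    simp [Module.finrank_prod]; omega
  obtain ⟨w, hw, hw0⟩ := Submodule.exists_mem_ne_zero_of_ne_bot h
  have : (⟪a, w⟫_ℝ, ⟪b, w⟫_ℝ) = ((0 : ℝ), (0 : ℝ)) := hw
  exact ⟨w, hw0, congrArg Prod.fst this, congrArg Prod.snd this⟩

end LinearAlgebra

/-! ### Reading maps and derivatives in a chart -/

section Chart

open Topology

variable {n : ℕ} {M : Type*} [TopologicalSpace M] [ChartedSpace (EuclideanSpace ℝ (Fin (2 * n))) M]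
  {p q : M}

/-- A map read in the chart at `p`. -/
def inChart {F : Type*} (p : M) (f : M → F) : EuclideanSpace ℝ (Fin (2 * n)) → F :=
  f ∘ (chartAt (EuclideanSpace ℝ (Fin (2 * n))) p).symm

/-- The derivative at `q` of the chart at `p`. -/
def chartDeriv (p q : M) : EuclideanSpace ℝ (Fin (2 * n)) →L[ℝ] EuclideanSpace ℝ (Fin (2 * n)) :=
  mfderiv (𝓡 (2 * n)) (𝓡 (2 * n)) (chartAt (EuclideanSpace ℝ (Fin (2 * n))) p) q

theorem inChart_apply (hq : q ∈ (chartAt (EuclideanSpace ℝ (Fin (2 * n))) p).source) {F : Type*} (f : M → F) :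
    inChart p f (chartAt (EuclideanSpace ℝ (Fin (2 * n))) p q) = f q := by
  simp [inChart, hq]

theorem eventually_chart_symm {P : M → Prop} (h : ∀ᶠ q in 𝓝 p, P q) :
    ∀ᶠ y in 𝓝 (chartAt (EuclideanSpace ℝ (Fin (2 * n))) p p),
      P ((chartAt (EuclideanSpace ℝ (Fin (2 * n))) p).symm y) := by
  have := (chartAt (EuclideanSpace ℝ (Fin (2 * n))) p).continuousAt_symm
    (mem_chart_target (EuclideanSpace ℝ (Fin (2 * n))) p)
  rw [ContinuousAt, OpenPartialHomeomorph.left_inv _ (mem_chart_source _ p)] at this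
  exact this.eventually h

theorem eventually_chart {P : EuclideanSpace ℝ (Fin (2 * n)) → Prop}
    (h : ∀ᶠ y in 𝓝 (chartAt (EuclideanSpace ℝ (Fin (2 * n))) p p), P y) :
    ∀ᶠ q in 𝓝 p, P (chartAt (EuclideanSpace ℝ (Fin (2 * n))) p q) :=
  ((chartAt (EuclideanSpace ℝ (Fin (2 * n))) p).continuousAt (mem_chart_source _ p)).eventually h

variable [IsManifold (𝓡 (2 * n)) ∞ M]
  {F : Type*} [NormedAddCommGroup F] [NormedSpace ℝ F]

theorem chartDeriv_bijective (hq : q ∈ (chartAt (EuclideanSpace ℝ (Fin (2 * n))) p).source) :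
    Function.Bijective (chartDeriv p q : EuclideanSpace ℝ (Fin (2 * n)) → _) :=
  have : IsManifold (𝓡 (2 * n)) 1 M := IsManifold.of_le (n := ∞) (by norm_cast)
  (mdifferentiable_chart (I := 𝓡 (2 * n)) p).mfderiv_bijective hq

theorem contDiffAt_inChart (hq : q ∈ (chartAt (EuclideanSpace ℝ (Fin (2 * n))) p).source)
    {f : M → F} (hf : ContMDiffAt (𝓡 (2 * n)) 𝓘(ℝ, F) 2 f q) :
    ContDiffAt ℝ 2 (inChart p f) (chartAt (EuclideanSpace ℝ (Fin (2 * n))) p q) := by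
  have : IsManifold (𝓡 (2 * n)) 2 M :=
    IsManifold.of_le (n := ∞) (WithTop.coe_le_coe.2 le_top)
  rw [← contMDiffAt_iff_contDiffAt]
  have h := contMDiffAt_symm_of_mem_maximalAtlas (I := 𝓡 (2 * n)) (n := 2)
    (IsManifold.chart_mem_maximalAtlas p)
    ((chartAt (EuclideanSpace ℝ (Fin (2 * n))) p).map_source hq)
  refine ContMDiffAt.comp _ ?_ h
  rwa [(chartAt (EuclideanSpace ℝ (Fin (2 * n))) p).left_inv hq]

theorem mfderiv_eq_inChart (hq : q ∈ (chartAt (EuclideanSpace ℝ (Fin (2 * n))) p).source)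
    {f : M → F} (hf : ContMDiffAt (𝓡 (2 * n)) 𝓘(ℝ, F) 2 f q) :
    (mfderiv (𝓡 (2 * n)) 𝓘(ℝ, F) f q : EuclideanSpace ℝ (Fin (2 * n)) →L[ℝ] F) =
      (fderiv ℝ (inChart p f) (chartAt (EuclideanSpace ℝ (Fin (2 * n))) p q)).comp
        (chartDeriv p q) := by
  have : IsManifold (𝓡 (2 * n)) 1 M := IsManifold.of_le (n := ∞) (by norm_cast)
  have h1 : f =ᶠ[𝓝 q] inChart p f ∘ chartAt (EuclideanSpace ℝ (Fin (2 * n))) p := by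
    filter_upwards [(chartAt (EuclideanSpace ℝ (Fin (2 * n))) p).open_source.mem_nhds hq] with y hy
    rw [Function.comp_apply, inChart_apply hy]
  have h2 : MDifferentiableAt (𝓡 (2 * n)) 𝓘(ℝ, F) (inChart p f)
      (chartAt (EuclideanSpace ℝ (Fin (2 * n))) p q) :=
    ((contDiffAt_inChart hq hf).differentiableAt (by norm_num)).mdifferentiableAt
  have h3 := (mdifferentiable_chart (I := 𝓡 (2 * n)) p).mdifferentiableAt hq
  rw [h1.mfderiv_eq, mfderiv_comp q h2 h3, mfderiv_eq_fderiv]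
  rfl

end Chart

/-! ### Nonintegrability of the contact distribution and singular points -/

section Singular

open Topology

theorem contactForm_eq_inner {n : ℕ} (p X : Heis n) :
    contactForm p X = X.2 + ⟪J n p.1, X.1⟫_ℝ := by
  simp only [contactForm, J, LinearMap.coe_mk, AddHom.coe_mk, PiLp.inner_apply,
    Fintype.sum_sum_type, Sum.elim_inl, Sum.elim_inr, ← Finset.sum_add_distrib]
  congr 1
  refine Finset.sum_congr rfl fun j _ => ?_
  simp
  ring

/-- The contact distribution has no integral manifolds of dimension `2n`. -/
theorem not_eventually_contactForm_eq_zero {n : ℕ} (hn : 0 < n) {E : Type*} [NormedAddCommGroup E]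
    [NormedSpace ℝ E] {g : E → Heis n} {x : E} (hg : ContDiffAt ℝ 2 g x)
    (hsurj : ∀ w, ∃ u, (fderiv ℝ g x u).1 = w) :
    ¬ ∀ᶠ y in 𝓝 x, ∀ u, contactForm (g y) (fderiv ℝ g y u) = 0 := by
  intro h
  let I : R2n n →L[ℝ] R2n n := LinearMap.toContinuousLinearMap (J n)
  -- This is the derivative of `Θ(dg v) = 0` in the direction `u`.
  have key : ∀ u v, (fderiv ℝ (fderiv ℝ g) x u v).2 + ⟪J n (g x).1, (fderiv ℝ (fderiv ℝ g) x u v).1⟫_ℝ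
      + ⟪J n (fderiv ℝ g x u).1, (fderiv ℝ g x v).1⟫_ℝ = 0 := by
    intro u v
    have h1 := hasFDerivAt_fderiv_apply hg v
    have h2 : HasFDerivAt (fun y => I (g y).1) _ x :=
      I.hasFDerivAt.comp x ((hg.differentiableAt (by norm_num)).hasFDerivAt.fst)
    have h3 := h1.snd.add (h2.inner ℝ h1.fst)
    have h4 : HasFDerivAt (fun y => (fderiv ℝ g y v).2 + ⟪I (g y).1, (fderiv ℝ g y v).1⟫_ℝ)
        (0 : E →L[ℝ] ℝ) x :=
      (hasFDerivAt_const (0 : ℝ) x).congr_of_eventuallyEq (h.mono fun y hy => by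
        have := hy v
        rwa [contactForm_eq_inner] at this)
    have h5 := DFunLike.congr_fun (h3.unique h4) u
    simp [I] at h5
    linarith
  obtain ⟨w, hw⟩ : ∃ w : R2n n, w ≠ 0 := by
    have : Nonempty (Fin n ⊕ Fin n) := ⟨Sum.inl ⟨0, hn⟩⟩
    exact exists_ne 0
  -- For `u`, `v` over `w`, `J w`, swapping them keeps the second-derivative terms but changes
  -- `|w|²` into `-|w|²`, so `w = 0`.
  obtain ⟨u, hu⟩ := hsurj w
  obtain ⟨v, hv⟩ := hsurj (J n w)
  have h1 := key u v
  have h2 := key v u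
  rw [fderiv_fderiv_comm hg] at h2
  rw [hu, hv] at h1 h2
  rw [inner_J_J] at h1
  rw [J_J, inner_neg_left] at h2
  have : ⟪w, w⟫_ℝ ≠ 0 := inner_self_ne_zero.2 hw
  apply this
  linarith

variable {n : ℕ} {M : Type*} [TopologicalSpace M] [ChartedSpace (EuclideanSpace ℝ (Fin (2 * n))) M]
  [IsManifold (𝓡 (2 * n)) ∞ M] {f : M → Heis n}

theorem IsHypersurface.df_eq (hf : IsHypersurface f) {p q : M}
    (hq : q ∈ (chartAt (EuclideanSpace ℝ (Fin (2 * n))) p).source) :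
    df f q = (fderiv ℝ (inChart p f) (chartAt (EuclideanSpace ℝ (Fin (2 * n))) p q)).comp
      (chartDeriv p q) :=
  mfderiv_eq_inChart hq (hf.contMDiff_two q)

theorem IsHypersurface.mem_tangent_iff (hf : IsHypersurface f) {p q : M}
    (hq : q ∈ (chartAt (EuclideanSpace ℝ (Fin (2 * n))) p).source) (X : Heis n) :
    X ∈ tangent f q ↔
      ∃ u, fderiv ℝ (inChart p f) (chartAt (EuclideanSpace ℝ (Fin (2 * n))) p q) u = X := by
  rw [tangent, LinearMap.mem_range, hf.df_eq hq]
  constructor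
  · rintro ⟨u, hu⟩
    exact ⟨_, hu⟩
  · rintro ⟨u, rfl⟩
    obtain ⟨v, rfl⟩ := (chartDeriv_bijective hq).2 u
    exact ⟨v, rfl⟩

/-- Transversality of `T` means that `(u, s) ↦ df u + s T` is injective. Injectivity is an open
condition, and this map depends continuously on the point. -/
theorem IsHypersurface.eventually_reeb_notMem (hf : IsHypersurface f) {p : M}
    (hp : reeb n ∉ tangent f p) : ∀ᶠ q in 𝓝 p, reeb n ∉ tangent f q := by
  set φ := chartAt (EuclideanSpace ℝ (Fin (2 * n))) p with hφ
  let L : EuclideanSpace ℝ (Fin (2 * n)) → (EuclideanSpace ℝ (Fin (2 * n)) × ℝ →L[ℝ] Heis n) :=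
    fun y => (fderiv ℝ (inChart p f) y).comp (ContinuousLinearMap.fst ℝ _ ℝ)
      + (ContinuousLinearMap.snd ℝ _ ℝ).smulRight (reeb n)
  have hp' := mem_chart_source (EuclideanSpace ℝ (Fin (2 * n))) p
  have hL : ContinuousAt L (φ p) := by
    have := (hasFDerivAt_fderiv
      (contDiffAt_inChart hp' (hf.contMDiff_two p))).continuousAt
    exact (this.clm_comp continuousAt_const).add continuousAt_const
  have hinj : Function.Injective (fderiv ℝ (inChart p f) (φ p)) := by
    have h := hf.immersion p
    rw [hf.df_eq hp', ContinuousLinearMap.coe_comp] at h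
    exact h.of_comp_right (chartDeriv_bijective hp').2
  have hLp : Function.Injective (L (φ p)) := by
    rw [injective_iff_map_eq_zero]
    rintro ⟨u, s⟩ h
    have h' : fderiv ℝ (inChart p f) (φ p) u + s • reeb n = 0 := h
    have hs : s = 0 := by
      by_contra hs
      refine hp ((hf.mem_tangent_iff hp' _).2 ⟨-s⁻¹ • u, ?_⟩)
      rw [map_smul, eq_neg_of_add_eq_zero_left h', smul_neg, neg_smul, neg_neg, smul_smul,
        inv_mul_cancel₀ hs, one_smul]
    rw [hs, zero_smul, add_zero] at h'
    rw [hs, (injective_iff_map_eq_zero _).1 hinj u h']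
    rfl
  have hev := eventually_chart (p := p)
    (hL.eventually (ContinuousLinearMap.isOpen_injective.mem_nhds hLp))
  filter_upwards [hev, φ.open_source.mem_nhds hp'] with q hq hqs hmem
  obtain ⟨u, hu⟩ := (hf.mem_tangent_iff hqs _).1 hmem
  have : L (φ q) (u, -1) = 0 := by
    change fderiv ℝ (inChart p f) (φ q) u + (-1 : ℝ) • reeb n = 0
    rw [hu]; simp
  have h0 := (injective_iff_map_eq_zero _).1 hq _ this
  simpa using congrArg Prod.snd h0

theorem IsHypersurface.not_eventually_singular (hn : 0 < n) (hf : IsHypersurface f) (p : M) :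
    ¬ ∀ᶠ q in 𝓝 p, tangent f q = contactPlane (f q) := by
  intro h
  have hp' := mem_chart_source (EuclideanSpace ℝ (Fin (2 * n))) p
  refine not_eventually_contactForm_eq_zero hn
    (contDiffAt_inChart hp' (hf.contMDiff_two p)) (fun w => ?_) ?_
  · have : lift (f p) w ∈ tangent f p := by
      rw [h.self_of_nhds]
      exact contactForm_lift _ _
    obtain ⟨u, hu⟩ := (hf.mem_tangent_iff hp' _).1 this
    exact ⟨u, by rw [hu, lift_fst]⟩
  · filter_upwards [eventually_chart_symm h,
      (chartAt (EuclideanSpace ℝ (Fin (2 * n))) p).open_target.mem_nhds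
        (mem_chart_target (EuclideanSpace ℝ (Fin (2 * n))) p)] with y hy hyt u
    have hs := (chartAt (EuclideanSpace ℝ (Fin (2 * n))) p).map_target hyt
    have := (hf.mem_tangent_iff hs (fderiv ℝ (inChart p f) y u)).2
      ⟨u, by rw [OpenPartialHomeomorph.right_inv _ hyt]⟩
    rw [hy] at this
    exact this

end Singular

/-! ### Local structure of umbilic hypersurfaces with vanishing `α` -/

section Umbilic

open Topology

variable {n : ℕ} {M : Type*} [TopologicalSpace M] [ChartedSpace (EuclideanSpace ℝ (Fin (2 * n))) M]
  {f : M → Heis n}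

/-- An umbilic hypersurface with `α = 0` at all regular points. -/
structure IsVerticalUmbilic (f : M → Heis n) : Prop where
  isHypersurface : IsHypersurface f
  isUmbilic : IsUmbilic f
  alpha_eq_zero : ∀ p, IsRegularPoint f p → ∀ v, IsCharDir f p v → alpha f p v = 0

namespace IsVerticalUmbilic

theorem mem_tangent_iff (h : IsVerticalUmbilic f) {p : M} (hp : IsRegularPoint f p) {v : R2n n}
    (hv : IsCharDir f p v) (X : Heis n) : X ∈ tangent f p ↔ ⟪J n v, X.1⟫_ℝ = 0 :=
  Heisenberg.mem_tangent_iff (h.isHypersurface.immersion p) hp hv (h.alpha_eq_zero p hp v hv) X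

/-- There are no singular points. -/
theorem isRegularPoint [IsManifold (𝓡 (2 * n)) ∞ M] (hn : 2 ≤ n) (h : IsVerticalUmbilic f)
    (p : M) : IsRegularPoint f p := by
  by_contra hp
  rw [IsRegularPoint, not_not] at hp
  have hT : reeb n ∉ tangent f p := by
    rw [hp]
    intro hT
    have h1 : contactForm (f p) (reeb n) = 0 := hT
    rw [contactForm_reeb] at h1
    exact one_ne_zero h1
  -- `T` is transverse near `p` but tangent at every regular point, so all nearby points would be
  -- singular.
  refine h.isHypersurface.not_eventually_singular (by omega) p ?_
  filter_upwards [h.isHypersurface.eventually_reeb_notMem hT] with q hq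
  by_contra hreg
  obtain ⟨U, e, he, hqU, -⟩ := h.isUmbilic q hreg
  exact hq ((h.mem_tangent_iff hreg (he.charDir q hqU) _).2 (by simp [reeb]))

theorem mem_xiPrime_iff (h : IsVerticalUmbilic f) {p : M} (hp : IsRegularPoint f p) {v : R2n n}
    (hv : IsCharDir f p v) (w : R2n n) :
    w ∈ xiPrime f p ↔ ⟪J n v, w⟫_ℝ = 0 ∧ ⟪v, w⟫_ℝ = 0 :=
  Heisenberg.mem_xiPrime_iff (h.mem_tangent_iff hp hv) w

/-- `J v` and `J v'` are unit normals of the same hyperplane. -/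
theorem charDir_eq_smul (h : IsVerticalUmbilic f) {p : M} (hp : IsRegularPoint f p) {v v' : R2n n}
    (hv : IsCharDir f p v) (hv' : IsCharDir f p v') :
    v' = ⟪v, v'⟫_ℝ • v ∧ ⟪v, v'⟫_ℝ * ⟪v, v'⟫_ℝ = 1 := by
  have hvv : ⟪v, v⟫_ℝ = 1 := by rw [real_inner_self_eq_norm_sq, hv.2.2]; norm_num
  have hvv' : ⟪v', v'⟫_ℝ = 1 := by rw [real_inner_self_eq_norm_sq, hv'.2.2]; norm_num
  have hw : v' = ⟪v, v'⟫_ℝ • v := by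
    have h1 : ⟪J n v, J n (v' - ⟪v, v'⟫_ℝ • v)⟫_ℝ = 0 := by
      rw [inner_J_J, inner_sub_right, inner_smul_right, hvv]; simp
    have h2 := (h.mem_tangent_iff hp hv (J n (v' - ⟪v, v'⟫_ℝ • v), 0)).2 h1
    rw [h.mem_tangent_iff hp hv', inner_J_J] at h2
    rw [inner_J_J] at h1
    rw [← sub_eq_zero, ← inner_self_eq_zero (𝕜 := ℝ)]
    nth_rw 1 [inner_sub_left]
    rw [inner_smul_left, h1, h2]; simp
  refine ⟨hw, ?_⟩
  nth_rw 1 [hw] at hvv'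
  rw [inner_smul_left] at hvv'
  simpa using hvv'

/-- The factor `⟪e q, e' q⟫` is continuous with values `±1`, hence locally constant. -/
theorem eventually_eq_smul (h : IsVerticalUmbilic f) {U U' : Set M} {e e' : M → R2n n}
    (he : IsCharField f U e) (he' : IsCharField f U' e') {p : M} (hp : p ∈ U) (hp' : p ∈ U') :
    ∃ s : ℝ, s * s = 1 ∧ ∀ᶠ q in 𝓝 p, e' q = s • e q := by
  have hc : ContinuousAt (fun q => ⟪e q, e' q⟫_ℝ) p :=
    (he.smooth.continuousOn.continuousAt (he.isOpen.mem_nhds hp)).inner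
      (he'.smooth.continuousOn.continuousAt (he'.isOpen.mem_nhds hp'))
  have hs : ∀ q ∈ U, q ∈ U' → e' q = ⟪e q, e' q⟫_ℝ • e q ∧ ⟪e q, e' q⟫_ℝ * ⟪e q, e' q⟫_ℝ = 1 :=
    fun q hq hq' => h.charDir_eq_smul (he.regular q hq) (he.charDir q hq) (he'.charDir q hq')
  refine ⟨⟪e p, e' p⟫_ℝ, (hs p hp hp').2, ?_⟩
  have hc' : ContinuousAt (fun q => ⟪e p, e' p⟫_ℝ * ⟪e q, e' q⟫_ℝ) p :=
    continuousAt_const.mul hc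
  have hpos : 0 < ⟪e p, e' p⟫_ℝ * ⟪e p, e' p⟫_ℝ := by rw [(hs p hp hp').2]; exact one_pos
  filter_upwards [he.isOpen.mem_nhds hp, he'.isOpen.mem_nhds hp',
    hc'.eventually_const_lt hpos] with q hq hq' hlt
  have h1 := (hs q hq hq').2
  have h2 := (hs p hp hp').2
  have : ⟪e q, e' q⟫_ℝ = ⟪e p, e' p⟫_ℝ := by
    rcases mul_self_eq_one_iff.1 h1 with h1 | h1 <;> rcases mul_self_eq_one_iff.1 h2 with h2 | h2
      <;> rw [h1, h2] at hlt ⊢ <;> norm_num at hlt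
  rw [← this]
  exact (hs q hq hq').1

theorem contMDiffAt_normal {U : Set M} {e : M → R2n n} (he : IsCharField f U e) {p : M}
    (hp : p ∈ U) : ContMDiffAt (𝓡 (2 * n)) 𝓘(ℝ, R2n n) 2 (fun q => J n (e q)) p := by
  have h1 : ContMDiffAt (𝓡 (2 * n)) 𝓘(ℝ, R2n n) 2 e p :=
    (he.smooth.contMDiffAt (he.isOpen.mem_nhds hp)).of_le (WithTop.coe_le_coe.2 le_top)
  exact ((LinearMap.toContinuousLinearMap (J n)).contMDiff (n := 2)).contMDiffAt.comp p h1

theorem nabla_eq_smul {U : Set M} {e e' : M → R2n n}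
    (he : IsCharField f U e) {p : M} (hp : p ∈ U) {s : ℝ} (hs : ∀ᶠ q in 𝓝 p, e' q = s • e q)
    (u : EuclideanSpace ℝ (Fin (2 * n))) :
    nabla (fun q => J n (e' q)) p u = s • nabla (fun q => J n (e q)) p u := by
  have h1 : (fun q => J n (e' q)) =ᶠ[𝓝 p] s • fun q => J n (e q) := by
    filter_upwards [hs] with q hq
    rw [hq, map_smul, Pi.smul_apply]
  rw [nabla, h1.mfderiv_eq,
    const_smul_mfderiv ((contMDiffAt_normal he hp).mdifferentiableAt (by norm_num))]
  rfl

theorem isPrincipalValue_iff (h : IsVerticalUmbilic f) {p : M} (hp : IsRegularPoint f p)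
    {e : M → R2n n} (he : IsCharDir f p (e p)) {κ : ℝ} :
    IsPrincipalValue f e p κ ↔ ∀ u : EuclideanSpace ℝ (Fin (2 * n)), ∀ w ∈ xiPrime f p,
      df f p u = lift (f p) w → nabla (fun q => J n (e q)) p u = -κ • w := by
  simp only [IsPrincipalValue, shape, h.alpha_eq_zero p hp _ he, zero_smul, add_zero,
    neg_eq_iff_eq_neg, neg_smul]

theorem exists_df_eq (h : IsVerticalUmbilic f) {p : M} (hp : IsRegularPoint f p) {v : R2n n}
    (hv : IsCharDir f p v) {w : R2n n} (hw : ⟪J n v, w⟫_ℝ = 0) :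
    ∃ u, df f p u = lift (f p) w :=
  (h.mem_tangent_iff hp hv (lift (f p) w)).2 hw

theorem isPrincipalValue_unique (hn : 2 ≤ n) (h : IsVerticalUmbilic f) {p : M}
    (hp : IsRegularPoint f p) {e : M → R2n n} (he : IsCharDir f p (e p)) {κ κ' : ℝ}
    (hκ : IsPrincipalValue f e p κ) (hκ' : IsPrincipalValue f e p κ') : κ = κ' := by
  obtain ⟨w, hw0, hw1, hw2⟩ := exists_ne_zero_of_orthogonal hn (J n (e p)) (e p)
  obtain ⟨u, hu⟩ := h.exists_df_eq hp he hw1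
  have hw := (h.mem_xiPrime_iff hp he w).2 ⟨hw1, hw2⟩
  have := (hκ u w hw hu).symm.trans (hκ' u w hw hu)
  exact smul_left_injective ℝ hw0 this

theorem k_eq (hn : 2 ≤ n) (h : IsVerticalUmbilic f) {p : M}
    (hp : IsRegularPoint f p) {e : M → R2n n} (he : IsCharDir f p (e p)) {κ : ℝ}
    (hκ : IsPrincipalValue f e p κ) : k f e p = κ :=
  h.isPrincipalValue_unique hn hp he (Classical.epsilon_spec ⟨κ, hκ⟩) hκ

theorem isPrincipalValue_smul (h : IsVerticalUmbilic f) {U U' : Set M} {e e' : M → R2n n}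
    (he : IsCharField f U e) (he' : IsCharField f U' e') {p : M} (hp : p ∈ U) (hp' : p ∈ U') {s : ℝ}
    (hs : ∀ᶠ q in 𝓝 p, e' q = s • e q) {κ : ℝ} (hκ : IsPrincipalValue f e p κ) :
    IsPrincipalValue f e' p (s * κ) := by
  rw [h.isPrincipalValue_iff (he.regular p hp) (he.charDir p hp)] at hκ
  rw [h.isPrincipalValue_iff (he.regular p hp) (he'.charDir p hp')]
  intro u w hw hu
  rw [nabla_eq_smul he hp hs, hκ u w hw hu, smul_smul, mul_neg]

/-- Umbilicity supplies an eigenvalue for some local choice of `e_n`; it is carried over to `e` by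
the locally constant sign. -/
theorem isPrincipalValue_k (h : IsVerticalUmbilic f) {U : Set M}
    {e : M → R2n n} (he : IsCharField f U e) {p : M} (hp : p ∈ U) :
    IsPrincipalValue f e p (k f e p) := by
  obtain ⟨U', e', he', hp', -, κ, hκ⟩ := h.isUmbilic p (he.regular p hp)
  obtain ⟨s, -, hs⟩ := h.eventually_eq_smul he' he hp' hp
  exact Classical.epsilon_spec
    (p := fun κ => IsPrincipalValue f e p κ) ⟨_, h.isPrincipalValue_smul he' he hp' hp hs hκ⟩

theorem l_eq (h : IsVerticalUmbilic f) {p : M} (hp : IsRegularPoint f p) {e : M → R2n n}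
    (he : IsCharDir f p (e p)) {c : ℝ} {u : EuclideanSpace ℝ (Fin (2 * n))}
    (hu : df f p u = lift (f p) (e p))
    (hc : -nabla (fun q => J n (e q)) p u - c • e p ∈ xiPrime f p) : l f e p = c := by
  obtain ⟨u', hu', hc'⟩ : ∃ u : EuclideanSpace ℝ (Fin (2 * n)), df f p u = lift (f p) (e p) ∧
      -nabla (fun q => J n (e q)) p u - l f e p • e p ∈ xiPrime f p :=
    Classical.epsilon_spec (p := fun c : ℝ => ∃ u : EuclideanSpace ℝ (Fin (2 * n)),
      df f p u = lift (f p) (e p) ∧ -nabla (fun q => J n (e q)) p u - c • e p ∈ xiPrime f p)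
      ⟨c, u, hu, hc⟩
  obtain rfl := h.isHypersurface.immersion p (hu'.trans hu.symm)
  have h1 := ((h.mem_xiPrime_iff hp he _).1 hc).2
  have h2 := ((h.mem_xiPrime_iff hp he _).1 hc').2
  have hee : ⟪e p, e p⟫_ℝ = 1 := by rw [real_inner_self_eq_norm_sq, he.2.2]; norm_num
  rw [inner_sub_right, inner_smul_right, hee] at h1 h2
  linarith

/-- The part of the chart at `p` over `U`. -/
def chartDomain (p : M) (U : Set M) : Set (EuclideanSpace ℝ (Fin (2 * n))) :=
  (chartAt (EuclideanSpace ℝ (Fin (2 * n))) p).target ∩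
    (chartAt (EuclideanSpace ℝ (Fin (2 * n))) p).symm ⁻¹' U

theorem mem_chartDomain {p : M} {U : Set M} {y : EuclideanSpace ℝ (Fin (2 * n))}
    (hy : y ∈ chartDomain p U) :
    ∃ q ∈ (chartAt (EuclideanSpace ℝ (Fin (2 * n))) p).source, q ∈ U ∧
      chartAt (EuclideanSpace ℝ (Fin (2 * n))) p q = y :=
  ⟨_, OpenPartialHomeomorph.map_target _ hy.1, hy.2, OpenPartialHomeomorph.right_inv _ hy.1⟩

theorem eventually_eq_of_hasFDerivAt_zero {F : Type*} [NormedAddCommGroup F] [NormedSpace ℝ F]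
    {p : M} {g : M → F}
    (hg : ∀ᶠ q in 𝓝 p, HasFDerivAt (inChart p g) (0 : EuclideanSpace ℝ (Fin (2 * n)) →L[ℝ] F)
      (chartAt (EuclideanSpace ℝ (Fin (2 * n))) p q)) : ∀ᶠ q in 𝓝 p, g q = g p := by
  set φ := chartAt (EuclideanSpace ℝ (Fin (2 * n))) p with hφ
  have h1 : ∀ᶠ y in 𝓝 (φ p), HasFDerivAt (inChart p g)
      (0 : EuclideanSpace ℝ (Fin (2 * n)) →L[ℝ] F) y := by
    filter_upwards [eventually_chart_symm hg, φ.open_target.mem_nhds (mem_chart_target _ p)]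
      with y hy hyt
    rwa [← hφ, φ.right_inv hyt] at hy
  obtain ⟨r, hr, hball⟩ := Metric.eventually_nhds_iff_ball.1 h1
  have h2 : ∀ y ∈ Metric.ball (φ p) r, inChart p g y = inChart p g (φ p) := fun y hy =>
    Metric.isOpen_ball.is_const_of_fderiv_eq_zero (convex_ball _ _).isPreconnected
      (fun z hz => (hball z hz).differentiableAt.differentiableWithinAt)
      (fun z hz => (hball z hz).fderiv) hy (Metric.mem_ball_self hr)
  filter_upwards [eventually_chart (Filter.eventually_of_mem (Metric.ball_mem_nhds _ hr) h2),
    φ.open_source.mem_nhds (mem_chart_source _ p)] with q hq hqs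
  rwa [inChart_apply hqs, inChart_apply (mem_chart_source _ p)] at hq

theorem mem_chartDomain_of_mem {p q : M} {U : Set M}
    (hq : q ∈ (chartAt (EuclideanSpace ℝ (Fin (2 * n))) p).source) (hqU : q ∈ U) :
    chartAt (EuclideanSpace ℝ (Fin (2 * n))) p q ∈ chartDomain p U :=
  ⟨OpenPartialHomeomorph.map_source _ hq, by
    rw [Set.mem_preimage, OpenPartialHomeomorph.left_inv _ hq]; exact hqU⟩

variable [IsManifold (𝓡 (2 * n)) ∞ M]

theorem fderiv_inChart_fst (hf : IsHypersurface f) {p q : M}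
    (hq : q ∈ (chartAt (EuclideanSpace ℝ (Fin (2 * n))) p).source)
    (u : EuclideanSpace ℝ (Fin (2 * n))) :
    fderiv ℝ (inChart (n := n) p fun q => (f q).1) (chartAt (EuclideanSpace ℝ (Fin (2 * n))) p q) u =
      (fderiv ℝ (inChart p f) (chartAt (EuclideanSpace ℝ (Fin (2 * n))) p q) u).1 := by
  have h1 := ((contDiffAt_inChart hq (hf.contMDiff_two q)).differentiableAt
    (by norm_num)).hasFDerivAt.fst
  have h2 : HasFDerivAt (inChart (n := n) p fun q => (f q).1) _ _ := h1
  rw [h2.fderiv]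
  rfl

/-- The bridge to Euclidean geometry: the tangent space is the preimage of `(J e_n)ᗮ` under the
projection, `ξ'` is the complement of `ν = J e_n` and `I ν = -e_n`, and `∇` differentiates
components. -/
theorem isComplexUmbilic (hn : 2 ≤ n) (h : IsVerticalUmbilic f) {U : Set M}
    {e : M → R2n n} (he : IsCharField f U e) (p : M) :
    IsComplexUmbilic (LinearMap.toContinuousLinearMap (J n)) (chartDomain p U)
      (inChart (n := n) p fun q => (f q).1) (inChart (n := n) p fun q => J n (e q))
      (inChart (n := n) p fun q => k f e q) where
  isOpen := (chartAt (EuclideanSpace ℝ (Fin (2 * n))) p).isOpen_inter_preimage_symm he.isOpen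
  contDiffAt y hy := by
    obtain ⟨q, hq, -, rfl⟩ := mem_chartDomain hy
    exact (contDiffAt_inChart hq (h.isHypersurface.contMDiff_two q)).fst
  contDiffAt_normal y hy := by
    obtain ⟨q, hq, hqU, rfl⟩ := mem_chartDomain hy
    exact contDiffAt_inChart hq (contMDiffAt_normal he hqU)
  I_I := J_J
  inner_I := inner_J
  inner_normal_self y hy := by
    obtain ⟨q, hq, hqU, rfl⟩ := mem_chartDomain hy
    rw [inChart_apply hq, inner_J_J, real_inner_self_eq_norm_sq, (he.charDir q hqU).2.2]
    norm_num
  inner_normal y hy u := by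
    obtain ⟨q, hq, hqU, rfl⟩ := mem_chartDomain hy
    rw [inChart_apply hq, fderiv_inChart_fst h.isHypersurface hq,
      ← h.mem_tangent_iff (he.regular q hqU) (he.charDir q hqU), h.isHypersurface.mem_tangent_iff hq]
    exact ⟨u, rfl⟩
  exists_fderiv_eq y hy w hw := by
    obtain ⟨q, hq, hqU, rfl⟩ := mem_chartDomain hy
    rw [inChart_apply hq] at hw
    have := (h.mem_tangent_iff (he.regular q hqU) (he.charDir q hqU) (lift (f q) w)).2 hw
    obtain ⟨u, hu⟩ := (h.isHypersurface.mem_tangent_iff hq _).1 this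
    exact ⟨u, by rw [fderiv_inChart_fst h.isHypersurface hq, hu, lift_fst]⟩
  umbilic y hy w hw hw' := by
    obtain ⟨q, hq, hqU, rfl⟩ := mem_chartDomain hy
    rw [inChart_apply hq] at hw hw'
    have hw2 : ⟪e q, w⟫_ℝ = 0 := by
      have : LinearMap.toContinuousLinearMap (J n) (J n (e q)) = -e q := J_J _
      rw [this, inner_neg_left] at hw'
      linarith
    obtain ⟨u, hu⟩ := h.exists_df_eq (he.regular q hqU) (he.charDir q hqU) hw
    have hk := (h.isPrincipalValue_iff (he.regular q hqU) (he.charDir q hqU)).1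
      (h.isPrincipalValue_k he hqU) u w
      ((h.mem_xiPrime_iff (he.regular q hqU) (he.charDir q hqU) w).2 ⟨hw, hw2⟩) hu
    rw [nabla, mfderiv_eq_inChart hq (contMDiffAt_normal he hqU)] at hk
    rw [h.isHypersurface.df_eq hq] at hu
    refine ⟨chartDeriv p q u, ?_, ?_⟩
    · rw [fderiv_inChart_fst h.isHypersurface hq]
      exact congrArg Prod.fst hu
    · rw [inChart_apply hq]
      exact hk
  exists_ne_zero y hy := exists_ne_zero_of_orthogonal hn _ _

/-- Evaluating the formula for `dν` along `e_n = -I ν` identifies `k + m` as the principal value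
`l`; no `ξ'` component occurs. -/
theorem exists_nabla_eq (h : IsVerticalUmbilic f) {U : Set M}
    {e : M → R2n n} (he : IsCharField f U e) {p q : M}
    (hq : q ∈ (chartAt (EuclideanSpace ℝ (Fin (2 * n))) p).source) (hqU : q ∈ U)
    {m : EuclideanSpace ℝ (Fin (2 * n)) → ℝ}
    (hm : ∀ x ∈ chartDomain p U, ∀ u, fderiv ℝ (inChart (n := n) p fun q => J n (e q)) x u =
      -inChart (n := n) p (fun q => k f e q) x • fderiv ℝ (inChart (n := n) p fun q => (f q).1) x u
        - (m x * ⟪LinearMap.toContinuousLinearMap (J n) (inChart (n := n) p (fun q => J n (e q)) x),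
            fderiv ℝ (inChart (n := n) p fun q => (f q).1) x u⟫_ℝ) •
          LinearMap.toContinuousLinearMap (J n) (inChart (n := n) p (fun q => J n (e q)) x)) :
    ∃ u, df f q u = lift (f q) (e q) ∧ nabla (fun q => J n (e q)) q u =
      -(k f e q + m (chartAt (EuclideanSpace ℝ (Fin (2 * n))) p q)) • e q := by
  have hchar := he.charDir q hqU
  have hy := mem_chartDomain_of_mem hq hqU
  obtain ⟨u, hu⟩ := h.exists_df_eq (he.regular q hqU) hchar (w := e q) (inner_J_self _)
  refine ⟨u, hu, ?_⟩
  rw [h.isHypersurface.df_eq hq] at hu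
  have h1 : fderiv ℝ (inChart (n := n) p fun q => (f q).1)
      (chartAt (EuclideanSpace ℝ (Fin (2 * n))) p q) (chartDeriv p q u) = e q := by
    rw [fderiv_inChart_fst h.isHypersurface hq]
    exact congrArg Prod.fst hu
  have hI : LinearMap.toContinuousLinearMap (J n) (J n (e q)) = -e q := J_J _
  have hee : ⟪e q, e q⟫_ℝ = 1 := by rw [real_inner_self_eq_norm_sq, hchar.2.2]; norm_num
  have hD : nabla (fun q => J n (e q)) q u = fderiv ℝ (inChart (n := n) p fun q => J n (e q))
      (chartAt (EuclideanSpace ℝ (Fin (2 * n))) p q) (chartDeriv p q u) := by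
    rw [nabla, mfderiv_eq_inChart hq (contMDiffAt_normal he hqU)]
    rfl
  rw [hD, hm _ hy, h1, inChart_apply hq, inChart_apply hq, hI, inner_neg_left, hee]
  module

theorem exists_nabla_eq_l (hn : 2 ≤ n) (h : IsVerticalUmbilic f) {U : Set M}
    {e : M → R2n n} (he : IsCharField f U e) {p : M} (hp : p ∈ U) :
    ∃ u, df f p u = lift (f p) (e p) ∧ nabla (fun q => J n (e q)) p u = -l f e p • e p := by
  obtain ⟨m, hm⟩ := (h.isComplexUmbilic hn he p).exists_fderiv_normal_eq
  obtain ⟨u, hu, hD⟩ := h.exists_nabla_eq he (mem_chart_source _ p) hp hm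
  refine ⟨u, hu, ?_⟩
  rw [hD, h.l_eq (he.regular p hp) (he.charDir p hp) hu]
  convert Submodule.zero_mem (xiPrime f p) using 1
  rw [hD]
  module

/-- At each point `l = k` or `k = 0`; in a chart, `k` has derivative zero, and the derivative of
the normal is governed by `k` and `l`. -/
theorem local_structure (hn : 2 ≤ n) (h : IsVerticalUmbilic f) {U : Set M}
    {e : M → R2n n} (he : IsCharField f U e) (p : M) {q : M}
    (hq : q ∈ (chartAt (EuclideanSpace ℝ (Fin (2 * n))) p).source) (hqU : q ∈ U) :
    (k f e q ≠ 0 → l f e q = k f e q) ∧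
    HasFDerivAt (inChart (n := n) p fun q => k f e q) (0 : EuclideanSpace ℝ (Fin (2 * n)) →L[ℝ] ℝ)
      (chartAt (EuclideanSpace ℝ (Fin (2 * n))) p q) ∧
    (l f e q = k f e q → HasFDerivAt (inChart (n := n) p fun q => J n (e q))
      (-k f e q • fderiv ℝ (inChart (n := n) p fun q => (f q).1)
        (chartAt (EuclideanSpace ℝ (Fin (2 * n))) p q))
      (chartAt (EuclideanSpace ℝ (Fin (2 * n))) p q)) := by
  have H := h.isComplexUmbilic hn he p
  obtain ⟨m, hm⟩ := H.exists_fderiv_normal_eq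
  have hy : chartAt (EuclideanSpace ℝ (Fin (2 * n))) p q ∈ chartDomain p U :=
    mem_chartDomain_of_mem hq hqU
  obtain ⟨hmk, hk⟩ := H.mul_eq_zero_and_fderiv_eq_zero hm hy
  set y := chartAt (EuclideanSpace ℝ (Fin (2 * n))) p q with hydef
  have hκ : inChart p (fun q => k f e q) y = k f e q := inChart_apply hq _
  have hl : l f e q = k f e q + m y := by
    obtain ⟨u, hu, hD⟩ := h.exists_nabla_eq he hq hqU hm
    refine h.l_eq (he.regular q hqU) (he.charDir q hqU) hu ?_
    convert Submodule.zero_mem (xiPrime f q) using 1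
    rw [hD]
    module
  refine ⟨fun hk0 => ?_, ?_, fun hlk => ?_⟩
  · rw [hκ] at hmk
    rw [hl, (mul_eq_zero.1 hmk).resolve_right hk0, add_zero]
  · rw [← hk]
    exact (H.differentiableAt_principalValue hm hy).1.hasFDerivAt
  · have hm0 : m y = 0 := by linarith
    refine (H.hasFDerivAt_normal hy).congr_fderiv (ContinuousLinearMap.ext fun u => ?_)
    rw [hm y hy, hm0, hκ]
    simp

theorem eventually_k_eq (hn : 2 ≤ n) (h : IsVerticalUmbilic f) {U : Set M}
    {e : M → R2n n} (he : IsCharField f U e) {p : M} (hp : p ∈ U) :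
    ∀ᶠ q in 𝓝 p, k f e q = k f e p := by
  refine eventually_eq_of_hasFDerivAt_zero (n := n) (g := fun q => k f e q) ?_
  filter_upwards [he.isOpen.mem_nhds hp, (chartAt (EuclideanSpace ℝ (Fin (2 * n))) p).open_source.mem_nhds
    (mem_chart_source _ p)] with q hqU hq
  exact (h.local_structure hn he p hq hqU).2.1

theorem l_eq_k (hn : 2 ≤ n) (h : IsVerticalUmbilic f) {U : Set M}
    {e : M → R2n n} (he : IsCharField f U e) {p : M} (hp : p ∈ U) (hk : k f e p ≠ 0) :
    l f e p = k f e p :=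
  (h.local_structure hn he p (mem_chart_source _ p) hp).1 hk

/-- When `l = k`, `dν = -k dπ` with `k` locally constant. The constant is `k` times the centre of
the sphere if `k ≠ 0`, and the normal itself if `k = 0`. -/
theorem eventually_normal_add_eq (hn : 2 ≤ n) (h : IsVerticalUmbilic f) {U : Set M}
    {e : M → R2n n} (he : IsCharField f U e) {p : M} (hp : p ∈ U)
    (hl : ∀ᶠ q in 𝓝 p, l f e q = k f e q) :
    ∀ᶠ q in 𝓝 p, J n (e q) + k f e p • (f q).1 = J n (e p) + k f e p • (f p).1 := by
  refine eventually_eq_of_hasFDerivAt_zero (n := n) (g := fun q => J n (e q) + k f e p • (f q).1) ?_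
  filter_upwards [he.isOpen.mem_nhds hp, (chartAt (EuclideanSpace ℝ (Fin (2 * n))) p).open_source.mem_nhds
    (mem_chart_source _ p), hl, h.eventually_k_eq hn he hp] with q hqU hq hlq hkq
  have h1 := (h.local_structure hn he p hq hqU).2.2 hlq
  have h2 : DifferentiableAt ℝ (inChart (n := n) p fun q => (f q).1) _ :=
    ((contDiffAt_inChart hq (h.isHypersurface.contMDiff_two q)).fst).differentiableAt (by norm_num)
  refine (h1.add (h2.hasFDerivAt.const_smul (k f e p))).congr_fderiv ?_
  rw [hkq]
  ext1 u
  simp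

theorem eventually_inner_eq (hn : 2 ≤ n) (h : IsVerticalUmbilic f) {U : Set M}
    {e : M → R2n n} (he : IsCharField f U e) {p : M} (hp : p ∈ U)
    (hν : ∀ᶠ q in 𝓝 p, J n (e q) = J n (e p)) :
    ∀ᶠ q in 𝓝 p, ⟪J n (e p), (f q).1⟫_ℝ = ⟪J n (e p), (f p).1⟫_ℝ := by
  refine eventually_eq_of_hasFDerivAt_zero (n := n) (g := fun q => ⟪J n (e p), (f q).1⟫_ℝ) ?_
  filter_upwards [he.isOpen.mem_nhds hp, (chartAt (EuclideanSpace ℝ (Fin (2 * n))) p).open_source.mem_nhds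
    (mem_chart_source _ p), hν] with q hqU hq hνq
  have h2 : DifferentiableAt ℝ (inChart (n := n) p fun q => (f q).1) _ :=
    ((contDiffAt_inChart hq (h.isHypersurface.contMDiff_two q)).fst).differentiableAt (by norm_num)
  have h3 := (innerSL ℝ (J n (e p))).hasFDerivAt.comp _ h2.hasFDerivAt
  refine h3.congr_fderiv (ContinuousLinearMap.ext fun u => ?_)
  have hy : chartAt (EuclideanSpace ℝ (Fin (2 * n))) p q ∈ chartDomain p U :=
    mem_chartDomain_of_mem hq hqU
  have h4 := (h.isComplexUmbilic hn he p).inner_normal _ hy u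
  rw [inChart_apply hq, hνq] at h4
  exact h4

/-- Replacing `e_n` by another choice multiplies `e_n`, `k` and `l` by the same sign. -/
theorem exists_sign (hn : 2 ≤ n) (h : IsVerticalUmbilic f) {U U' : Set M} {e e' : M → R2n n}
    (he : IsCharField f U e) (he' : IsCharField f U' e') {p : M} (hp : p ∈ U) (hp' : p ∈ U') :
    ∃ s : ℝ, s * s = 1 ∧ e' p = s • e p ∧ k f e' p = s * k f e p ∧
      l f e' p = s * l f e p := by
  obtain ⟨s, hs1, hs⟩ := h.eventually_eq_smul he he' hp hp'
  refine ⟨s, hs1, hs.self_of_nhds, h.k_eq hn (he.regular p hp) (he'.charDir p hp')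
    (h.isPrincipalValue_smul he he' hp hp' hs (h.isPrincipalValue_k he hp)), ?_⟩
  obtain ⟨u, hu, hD⟩ := h.exists_nabla_eq_l hn he hp
  -- Both the direction `e_n` and the field `e_{2n}` acquire a factor `s`, so the covariant
  -- derivative is unchanged and `l e = (s l)(s e)`.
  refine h.l_eq (he.regular p hp) (he'.charDir p hp') (u := s • u)
    (by rw [map_smul, hu, hs.self_of_nhds, map_smul]) ?_
  convert Submodule.zero_mem (xiPrime f p) using 1
  have hsmul : nabla (fun q => J n (e q)) p (s • u) = s • nabla (fun q => J n (e q)) p u :=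
    map_smul _ s u
  rw [nabla_eq_smul he hp hs, hsmul, hD, hs.self_of_nhds, smul_smul, hs1, mul_comm s,
    ← smul_smul, smul_smul s s, hs1]
  module

end IsVerticalUmbilic

end Umbilic

/-! ### From local to global on a connected hypersurface -/

section Global

open Topology

variable {n : ℕ} {M : Type*} [TopologicalSpace M] [ChartedSpace (EuclideanSpace ℝ (Fin (2 * n))) M]
  {f : M → Heis n} [IsManifold (𝓡 (2 * n)) ∞ M]

namespace IsVerticalUmbilic

theorem exists_charField (hn : 2 ≤ n) (h : IsVerticalUmbilic f) (p : M) :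
    ∃ (U : Set M) (e : M → R2n n), IsCharField f U e ∧ p ∈ U := by
  obtain ⟨U, e, he, hp, -⟩ := h.isUmbilic p (h.isRegularPoint hn p)
  exact ⟨U, e, he, hp⟩

theorem exists_k_eq (hn : 2 ≤ n) (h : IsVerticalUmbilic f) {U : Set M} {e : M → R2n n}
    (he : IsCharField f U e) (hU : IsPreconnected U) : ∃ c : ℝ, ∀ p ∈ U, k f e p = c := by
  rcases U.eq_empty_or_nonempty with rfl | ⟨p₀, hp₀⟩
  · exact ⟨0, fun p hp => hp.elim⟩
  refine ⟨k f e p₀, fun p hp => ?_⟩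
  have : PreconnectedSpace U := isPreconnected_iff_preconnectedSpace.1 hU
  have hloc : IsLocallyConstant fun q : U => k f e q := by
    rw [IsLocallyConstant.iff_eventually_eq]
    intro q
    exact continuousAt_subtype_val.eventually (h.eventually_k_eq hn he q.2)
  exact hloc.apply_eq_of_preconnectedSpace ⟨p, hp⟩ ⟨p₀, hp₀⟩

/-- No global choice of `e_n` is assumed; `|k|` does not depend on the sign, so it is a locally
constant function on all of `M`. -/
theorem abs_k_eq [PreconnectedSpace M] (hn : 2 ≤ n) (h : IsVerticalUmbilic f) {U U' : Set M}
    {e e' : M → R2n n} (he : IsCharField f U e) (he' : IsCharField f U' e') {p p' : M}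
    (hp : p ∈ U) (hp' : p' ∈ U') : |k f e p| = |k f e' p'| := by
  choose V ε hε hV using h.exists_charField hn
  have hsign : ∀ {U : Set M} {e : M → R2n n}, IsCharField f U e → ∀ q ∈ U,
      |k f (ε q) q| = |k f e q| := by
    intro U e he q hq
    obtain ⟨s, hs, -, hk, -⟩ := h.exists_sign hn he (hε q) hq (hV q)
    rw [hk, abs_mul]
    rcases mul_self_eq_one_iff.1 hs with rfl | rfl <;> simp
  have hloc : IsLocallyConstant fun q : M => |k f (ε q) q| := by
    rw [IsLocallyConstant.iff_eventually_eq]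
    intro q
    filter_upwards [h.eventually_k_eq hn (hε q) (hV q), (hε q).isOpen.mem_nhds (hV q)]
      with q' hk hq'
    rw [hsign (hε q) q' hq', hk]
  rw [← hsign he p hp, ← hsign he' p' hp']
  exact hloc.apply_eq_of_preconnectedSpace p p'

theorem isCongruentToPart_sphereCylinder [ConnectedSpace M] (hn : 2 ≤ n) (h : IsVerticalUmbilic f)
    {k₀ : ℝ} (hk₀ : 0 < k₀)
    (hk : ∀ (U : Set M) (e : M → R2n n) (p : M), IsCharField f U e → p ∈ U → |k f e p| = k₀) :
    IsCongruentToPart f (sphereCylinder n (1 / k₀)) := by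
  choose V ε hε hV using h.exists_charField hn
  have hne : ∀ (U : Set M) (e : M → R2n n) (p : M), IsCharField f U e → p ∈ U → k f e p ≠ 0 := by
    intro U e p he hp h0
    have := hk U e p he hp
    rw [h0, abs_zero] at this
    exact hk₀.ne this
  -- This is `k (ν + k π)`, since `k² = k₀²`. It is invariant under `e_n ↦ -e_n`, hence defined on
  -- `M`, and `G / k₀²` is the centre of the sphere.
  let G : M → R2n n := fun q => k f (ε q) q • J n (ε q q) + k₀ ^ 2 • (f q).1
  have hG : IsLocallyConstant G := by
    rw [IsLocallyConstant.iff_eventually_eq]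
    intro p
    have key : ∀ q ∈ V p, G q = k f (ε p) q • (J n (ε p q) + k f (ε p) q • (f q).1) := by
      intro q hq
      obtain ⟨s, hs, he, hks, -⟩ := h.exists_sign hn (hε p) (hε q) hq (hV q)
      have h2 : k₀ ^ 2 = k f (ε p) q * k f (ε p) q := by
        rw [← hk (V p) (ε p) q (hε p) hq, sq_abs, sq]
      simp only [G]
      rw [hks, he, map_smul, smul_smul, mul_right_comm, hs, one_mul, h2, smul_add, smul_smul]
    have hl : ∀ᶠ q in 𝓝 p, l f (ε p) q = k f (ε p) q := by
      filter_upwards [(hε p).isOpen.mem_nhds (hV p)] with q hq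
      exact h.l_eq_k hn (hε p) hq (hne _ _ _ (hε p) hq)
    filter_upwards [(hε p).isOpen.mem_nhds (hV p), h.eventually_k_eq hn (hε p) (hV p),
      h.eventually_normal_add_eq hn (hε p) (hV p) hl] with q hq hkq hνq
    rw [key q hq, key p (hV p), hkq, hνq]
  obtain ⟨p₀⟩ := (inferInstance : Nonempty M)
  refine ⟨(-(k₀ ^ 2)⁻¹ • G p₀, 0), fun q => ?_⟩
  change ‖-(k₀ ^ 2)⁻¹ • G p₀ + (f q).1‖ = 1 / k₀
  have hk0 : k₀ ^ 2 ≠ 0 := by positivity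
  have h1 : -(k₀ ^ 2)⁻¹ • G p₀ + (f q).1 = -((k₀ ^ 2)⁻¹ * k f (ε q) q) • J n (ε q q) := by
    rw [hG.apply_eq_of_preconnectedSpace p₀ q]
    simp only [G]
    rw [smul_add, smul_smul, smul_smul, neg_mul, neg_mul, inv_mul_cancel₀ hk0]
    module
  have h2 : ‖J n (ε q q)‖ = 1 := by
    have h3 := inner_J_J (ε q q) (ε q q)
    rw [real_inner_self_eq_norm_sq, real_inner_self_eq_norm_sq,
      ((hε q).charDir q (hV q)).2.2] at h3
    exact (sq_eq_sq₀ (norm_nonneg _) zero_le_one).1 h3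
  rw [h1, norm_smul, h2, norm_neg, norm_mul, Real.norm_eq_abs (k f _ _), hk _ _ _ (hε q) (hV q),
    norm_inv, norm_pow, Real.norm_of_nonneg hk₀.le]
  field_simp

theorem isCongruentToPart_hyperplaneCylinder [ConnectedSpace M] (hn : 2 ≤ n)
    (h : IsVerticalUmbilic f)
    (hkl : ∀ p, ∃ (U : Set M) (e : M → R2n n), IsCharField f U e ∧ p ∈ U ∧
      k f e p = 0 ∧ l f e p = 0) :
    ∃ A : R2n n, A ≠ 0 ∧ IsCongruentToPart f (hyperplaneCylinder A) := by
  choose V ε hε hV hk hl using hkl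
  have hν : ∀ p, ∀ᶠ q in 𝓝 p, J n (ε p q) = J n (ε p p) := by
    intro p
    have h0 : ∀ᶠ q in 𝓝 p, l f (ε p) q = k f (ε p) q := by
      filter_upwards [(hε p).isOpen.mem_nhds (hV p)] with q hq
      obtain ⟨s, -, -, h1, h2⟩ := h.exists_sign hn (hε q) (hε p) (hV q) hq
      rw [h1, h2, hk, hl]
    filter_upwards [h.eventually_normal_add_eq hn (hε p) (hV p) h0] with q hq
    simpa [hk] using hq
  obtain ⟨p₀⟩ := (inferInstance : Nonempty M)
  set A := J n (ε p₀ p₀) with hA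
  have hAA : ⟪A, A⟫_ℝ = 1 := by
    rw [hA, inner_J_J, real_inner_self_eq_norm_sq, ((hε p₀).charDir p₀ (hV p₀)).2.2]; norm_num
  -- The projection of `A` onto the normal line ignores the sign of the normal; its constancy says
  -- that the normal is `±A` everywhere.
  let G : M → R2n n := fun q => ⟪A, J n (ε q q)⟫_ℝ • J n (ε q q)
  have hG : IsLocallyConstant G := by
    rw [IsLocallyConstant.iff_eventually_eq]
    intro p
    filter_upwards [(hε p).isOpen.mem_nhds (hV p), hν p] with q hq hνq
    obtain ⟨s, hs, he, -⟩ := h.exists_sign hn (hε p) (hε q) hq (hV q)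
    simp only [G]
    rw [he, map_smul, hνq, inner_smul_right, smul_smul, mul_right_comm, hs, one_mul]
  have hGA : ∀ q, ⟪A, J n (ε q q)⟫_ℝ • J n (ε q q) = A := by
    intro q
    have h1 : G q = G p₀ := hG.apply_eq_of_preconnectedSpace q p₀
    simpa only [G, ← hA, hAA, one_smul] using h1
  have hloc : IsLocallyConstant fun q => ⟪A, (f q).1⟫_ℝ := by
    rw [IsLocallyConstant.iff_eventually_eq]
    intro p
    filter_upwards [h.eventually_inner_eq hn (hε p) (hV p) (hν p)] with q hq
    rw [← hGA p, inner_smul_left, inner_smul_left, hq]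
  refine ⟨A, fun h0 => ?_, (-(f p₀).1, 0), fun q => ?_⟩
  · rw [h0, inner_zero_left] at hAA
    exact zero_ne_one hAA
  · change ⟪A, -(f p₀).1 + (f q).1⟫_ℝ = 0
    rw [inner_add_right, inner_neg_right, hloc.apply_eq_of_preconnectedSpace q p₀,
      neg_add_cancel]

end IsVerticalUmbilic

end Global

end Heisenberg

end

theorem theorem1p5 (n : ℕ) (hn : 2 ≤ n)
    {M : Type*} [TopologicalSpace M] [ChartedSpace (EuclideanSpace ℝ (Fin (2 * n))) M]
    [IsManifold (𝓡 (2 * n)) ∞ M]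
    (f : M → Heisenberg.Heis n)
    (hf : Heisenberg.IsHypersurface f)
    (humb : Heisenberg.IsUmbilic f)
    (hα : ∀ p, Heisenberg.IsRegularPoint f p →
      ∀ v, Heisenberg.IsCharDir f p v → Heisenberg.alpha f p v = 0) :
    (∀ p, Heisenberg.IsRegularPoint f p) ∧
    (∀ (U : Set M) (e : M → Heisenberg.R2n n), Heisenberg.IsCharField f U e → IsPreconnected U →
      ∃ c : ℝ, ∀ p ∈ U, Heisenberg.k f e p = c) ∧
    (ConnectedSpace M →
      ∀ (U₀ : Set M) (e₀ : M → Heisenberg.R2n n) (p₀ : M), Heisenberg.IsCharField f U₀ e₀ →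
        p₀ ∈ U₀ → 0 < Heisenberg.k f e₀ p₀ →
        (∀ (U : Set M) (e : M → Heisenberg.R2n n) (p : M), Heisenberg.IsCharField f U e → p ∈ U →
          |Heisenberg.k f e p| = Heisenberg.k f e₀ p₀ ∧
          Heisenberg.l f e p = Heisenberg.k f e p) ∧
        Heisenberg.IsCongruentToPart f
          (Heisenberg.sphereCylinder n (1 / Heisenberg.k f e₀ p₀))) ∧
    (ConnectedSpace M →
      (∀ p, ∃ (U : Set M) (e : M → Heisenberg.R2n n), Heisenberg.IsCharField f U e ∧ p ∈ U ∧
        Heisenberg.k f e p = 0 ∧ Heisenberg.l f e p = 0) →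
      ∃ A : Heisenberg.R2n n, A ≠ 0 ∧
        Heisenberg.IsCongruentToPart f (Heisenberg.hyperplaneCylinder A)) := by
  have h : Heisenberg.IsVerticalUmbilic f := ⟨hf, humb, hα⟩
  refine ⟨h.isRegularPoint hn, fun U e he hU => h.exists_k_eq hn he hU, ?_, ?_⟩
  · intro _ U₀ e₀ p₀ he₀ hp₀ hpos
    have hk : ∀ (U : Set M) (e : M → Heisenberg.R2n n) (p : M), Heisenberg.IsCharField f U e →
        p ∈ U → |Heisenberg.k f e p| = Heisenberg.k f e₀ p₀ := fun U e p he hp => by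
      rw [h.abs_k_eq hn he he₀ hp hp₀, abs_of_pos hpos]
    refine ⟨fun U e p he hp => ⟨hk U e p he hp, h.l_eq_k hn he hp fun h0 => ?_⟩,
      h.isCongruentToPart_sphereCylinder hn hpos hk⟩
    have := hk U e p he hp
    rw [h0, abs_zero] at this
    exact hpos.ne this
  · intro _ hkl
    exact h.isCongruentToPart_hyperplaneCylinder hn hkl
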